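/- Let $d\ge 0$, $D\subseteq\mathbb{R}^d$ and $k\in\{1,2\}$. *Simplices and germs.* For $m\ge 0$, $\mathrm{Simp}^m(D)$ is the set of ordered tuples $S=[p_0\dots p_m]$ of points of $\mathbb{R}^d$ with $\mathrm{conv}\{p_0,\dots,p_m\}\subseteq D$, topologized by convergence of the vertices. An $m$-germ in $D$ is a function $\omega:\mathrm{Simp}^m(D)\to\mathbb{R}$, and $(\delta\omega)_{[p_0\dots p_{m+1}]}=\sum_{i=0}^{m+1}(-1)^i\omega_{[p_0\dots\hat p_i\dots p_{m+1}]}$. A $k$-germ $\omega$ is *nonatomic* if $\omega_S=0$ whenever the $k$-volume $\mathrm{vol}_k(S)$ vanishes, *closed on $k$-planes* if for every affine $\varphi:I\subseteq\mathbb{R}^k\to D$ the germ $[p_0\dots p_k]\mapsto\omega_{[\varphi(p_0)\dots\varphi(p_k)]}$ in $I$ has zero $\delta$, and *regular* if it is both. *Gauges.* An $m$-gauge is an $m$-germ $\mathsf{v}\ge 0$; it is *uniform* if it takes equal values on any two simplices whose ordered vertices correspond under an isometry of $\mathbb{R}^d$. Let $[\omega]_{\mathsf v}\in[0,\infty]$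 be the infimum of the constants $c\ge 0$ with $|\omega_S|\le c\,\mathsf v_S$ for all $S$; write $\omega\approx_{\mathsf v}\eta$ if $[\omega-\eta]_{\mathsf v}<\infty$. For $r\ge 0$, a uniform gauge $\mathsf u$ is *$r$-Dini* if $\lim_{n\to\infty}2^{nr}\mathsf u_{2^{-n}S}=0$ for every $S$, and *strong $r$-Dini* if moreover $\tilde{\mathsf u}_S:=\sum_{n\ge 0}2^{nr}\mathsf u_{2^{-n}S}<\infty$ for every $S$; here $2^{-n}S$ denotes any translate contained in $D$ of $[2^{-n}p_0\dots 2^{-n}p_m]$, for instance the one with first vertex $p_0$. *Sewing.* For a $k$-Dini gauge $\mathsf v$ on $k$-simplices, a $k$-germ $\omega$ is *$\mathsf v$-sewable* if there is a regular $k$-germ, denoted $\mathrm{sew}\,\omega$, with $\omega\approx_{\mathsf v}\mathrm{sew}\,\omega$. *Dyadic sums.* Let $\mathrm{dya}[p_0p_1]=[p_0q]+[qp_1]$ with $q=\frac{p_0+p_1}{2}$, and $\mathrm{dya}[p_0p_1p_2]=[p_0q_2q_1]+[q_2p_1q_0]+[q_1q_0p_2]+[q_0q_1q_2]$, where $q_i$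 is the midpoint of the side opposite to $p_i$; $\mathrm{dya}$ and $\omega$ are extended linearly to formal sums of simplices, $\langle C,\omega\rangle$ denoting the value of $\omega$ on the formal sum $C$. **Theorem (sewing, existence).** Let $\mathsf u$ be a continuous strong $k$-Dini gauge on $(k+1)$-simplices in $D$ such that $\tilde{\mathsf u}$ (with $r=k$) is continuous. Then there is a continuous $k$-Dini gauge $\mathsf v$ on $k$-simplices in $D$ such that every continuous, nonatomic $k$-germ $\omega$ in $D$ with $\delta\omega\approx_{\mathsf u}0$ is $\mathsf v$-sewable. Moreover $\mathrm{sew}\,\omega$ is uniquely determined (any regular $\eta'$ with $\omega\approx_{\mathsf w}\eta'$ for some $k$-Dini gauge $\mathsf w$ equals it), regular and continuous, it is given by $$(\mathrm{sew}\,\omega)_S=\lim_{n\to\infty}\langle \mathrm{dya}^n S,\omega\rangle\qquad\text{for every }S\in\mathrm{Simp}^k(D),$$ and $$[\omega-\mathrm{sew}\,\omega]_{\mathsf v}\le[\delta\omega]_{\mathsf u}.$$ -/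

import Mathlib

open Filter Topology
open scoped ENNReal NNReal

namespace RoughForm

noncomputable section

/-- `ℝ^d` with its Euclidean norm. -/
abbrev Space (d : ℕ) : Type := EuclideanSpace ℝ (Fin d)

/-- The `k`-simplices in `D`: ordered `(k+1)`-tuples `[p₀ p₁ … p_k]` of points whose convex hull is
contained in `D`. They carry the topology of convergence of the vertices. -/
abbrev Simplices {d : ℕ} (D : Set (Space d)) (k : ℕ) : Type :=
  {S : Fin (k + 1) → Space d // convexHull ℝ (Set.range S) ⊆ D}

/-- A `k`-germ in `D` is a real function on the `k`-simplices in `D`. -/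
abbrev Germ {d : ℕ} (D : Set (Space d)) (k : ℕ) : Type := Simplices D k → ℝ

section Operations

variable {d : ℕ} {D : Set (Space d)} {k m : ℕ}

/-- A simplex whose vertices lie in the convex hull of a simplex in `D` is again a simplex in `D`. -/
def Simplices.inside (S : Simplices D k) (q : Fin (m + 1) → Space d)
    (hq : ∀ i, q i ∈ convexHull ℝ (Set.range S.1)) : Simplices D m :=
  ⟨q, (convexHull_min (Set.range_subset_iff.2 hq) (convex_convexHull ℝ _)).trans S.2⟩

theorem Simplices.vertex_mem (S : Simplices D k) (i : Fin (k + 1)) :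
    S.1 i ∈ convexHull ℝ (Set.range S.1) :=
  subset_convexHull ℝ _ (Set.mem_range_self i)

theorem Simplices.midpoint_mem (S : Simplices D k) (i j : Fin (k + 1)) :
    midpoint ℝ (S.1 i) (S.1 j) ∈ convexHull ℝ (Set.range S.1) :=
  (convex_convexHull ℝ _).segment_subset (S.vertex_mem i) (S.vertex_mem j)
    (midpoint_mem_segment _ _)

/-- The face `[p₀ … p̂ᵢ … p_{k+1}]` obtained by deleting the `i`-th vertex. -/
def Simplices.face (S : Simplices D (k + 1)) (i : Fin (k + 2)) : Simplices D k :=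
  S.inside (fun j => S.1 (i.succAbove j)) fun _ => S.vertex_mem _

/-- The exterior derivative `(δω)_S = ∑ᵢ (-1)^i ω_{[p₀ … p̂ᵢ … p_{k+1}]}`. -/
def coboundary (ω : Germ D k) : Germ D (k + 1) :=
  fun S => ∑ i : Fin (k + 2), (-1 : ℝ) ^ (i : ℕ) * ω (S.face i)

/-- The `k`-dimensional volume `(1 / k!) √(det (P Pᵀ))`, where the rows of `P` are `pᵢ - p₀`,
`i = 1, …, k`. -/
def vol (S : Simplices D k) : ℝ :=
  let P : Matrix (Fin k) (Fin d) ℝ := Matrix.of fun i j => (S.1 i.succ - S.1 0) j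
  1 / (k.factorial : ℝ) * Real.sqrt (P * P.transpose).det

/-- The push-forward `[φ(p₀) … φ(p_k)]` of a simplex in `I` under an affine map `φ` that maps `I`
into `D`. -/
def Simplices.push {n : ℕ} {I : Set (Space n)} (φ : Space n →ᵃ[ℝ] Space d) (h : Set.MapsTo φ I D)
    (S : Simplices I k) : Simplices D k :=
  ⟨fun i => φ (S.1 i), by
    have e : Set.range (fun i => φ (S.1 i)) = φ '' Set.range S.1 := Set.range_comp φ S.1
    rw [e, ← AffineMap.image_convexHull]
    exact (Set.image_mono S.2).trans h.image_subset⟩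

/-- The pull-back of a germ under an affine map. -/
def pullback {n : ℕ} {I : Set (Space n)} (φ : Space n →ᵃ[ℝ] Space d) (h : Set.MapsTo φ I D)
    (ω : Germ D k) : Germ I k :=
  fun S => ω (S.push φ h)

/-- `ω` is nonatomic: it vanishes on simplices of zero `k`-volume. -/
def IsNonatomic (ω : Germ D k) : Prop :=
  ∀ S : Simplices D k, vol S = 0 → ω S = 0

/-- `ω` is closed on `k`-planes: `δ (φ^♮ ω) = 0` for every affine `φ : I ⊆ ℝ^k → D`. -/
def IsClosedOnPlanes (ω : Germ D k) : Prop :=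
  ∀ (I : Set (Space k)) (φ : Space k →ᵃ[ℝ] Space d) (h : Set.MapsTo φ I D),
    coboundary (pullback φ h ω) = 0

/-- `ω` is regular: nonatomic and closed on `k`-planes. -/
def IsRegular (ω : Germ D k) : Prop :=
  IsNonatomic ω ∧ IsClosedOnPlanes ω

/-- `[ω]_v ∈ [0, ∞]`: the infimum of all constants `c ≥ 0` such that `|ω_S| ≤ c v_S` for every
`S`. -/
def gaugeNorm (v ω : Germ D k) : ℝ≥0∞ :=
  ⨅ (c : ℝ≥0) (_ : ∀ S : Simplices D k, |ω S| ≤ (c : ℝ) * v S), (c : ℝ≥0∞)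

/-- `ω ≈_v η`. -/
def Near (v ω η : Germ D k) : Prop :=
  gaugeNorm v (ω - η) < ⊤

/-- Two simplices are isometric if some isometry of `ℝ^d` maps the vertices of the first one to
those of the second one, in order. -/
def AreIsometric (S S' : Simplices D k) : Prop :=
  ∃ f : Space d → Space d, Isometry f ∧ ∀ i, f (S.1 i) = S'.1 i

/-- A gauge is a nonnegative germ. -/
def IsGauge (u : Germ D k) : Prop :=
  ∀ S : Simplices D k, 0 ≤ u S

/-- A germ is uniform if it takes the same value on isometric simplices. -/
def IsUniform (u : Germ D k) : Prop :=
  ∀ S S' : Simplices D k, AreIsometric S S' → u S = u S'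

/-- The copy of the simplex `2^{-n} S` that shares its first vertex with `S`, i.e.
`[p₀, p₀ + 2^{-n}(p₁ - p₀), …, p₀ + 2^{-n}(p_k - p₀)]`. This translated copy always lies in `D`. -/
def Simplices.scale (S : Simplices D k) (n : ℕ) : Simplices D k :=
  S.inside (fun i => AffineMap.lineMap (S.1 0) (S.1 i) ((2 : ℝ)⁻¹ ^ n)) fun i =>
    (convex_convexHull ℝ _).lineMap_mem (S.vertex_mem 0) (S.vertex_mem i)
      ⟨by positivity, pow_le_one₀ (by norm_num) (by norm_num)⟩

/-- On a uniform germ the choice of the translated copy of `2^{-n} S` inside `D` is immaterial. -/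
theorem IsUniform.eq_scale {u : Germ D k} (hu : IsUniform u) (S S' : Simplices D k) (n : ℕ)
    (q : Space d) (h : ∀ i, S'.1 i = (2 : ℝ)⁻¹ ^ n • S.1 i + q) : u S' = u (S.scale n) := by
  refine hu _ _ ⟨fun x => x + ((1 - (2 : ℝ)⁻¹ ^ n) • S.1 0 - q), isometry_add_right _, fun i => ?_⟩
  rw [h i]
  simp only [Simplices.scale, Simplices.inside, AffineMap.lineMap_apply, vsub_eq_sub, vadd_eq_add]
  module

/-- `u` is an `r`-Dini gauge: a uniform gauge with `2^{nr} u(2^{-n} S) → 0` for every `S`. -/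
def IsDini (r : ℝ) (u : Germ D k) : Prop :=
  IsGauge u ∧ IsUniform u ∧
    ∀ S : Simplices D k,
      Tendsto (fun n : ℕ => (2 : ℝ) ^ ((n : ℝ) * r) * u (S.scale n)) atTop (𝓝 0)

/-- `u` is a strong `r`-Dini gauge: it is `r`-Dini and `∑ₙ 2^{nr} u(2^{-n} S) < ∞` for every
`S`. -/
def IsStrongDini (r : ℝ) (u : Germ D k) : Prop :=
  IsDini r u ∧
    ∀ S : Simplices D k, Summable fun n : ℕ => (2 : ℝ) ^ ((n : ℝ) * r) * u (S.scale n)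

/-- The summed gauge `ũ_S = ∑ₙ 2^{nr} u(2^{-n} S)` of a strong `r`-Dini gauge. -/
def summedGauge (r : ℝ) (u : Germ D k) : Germ D k :=
  fun S => ∑' n : ℕ, (2 : ℝ) ^ ((n : ℝ) * r) * u (S.scale n)

/-- The half-size copy of `S` at the vertex `p_j`: its `i`-th vertex is `(p_j + p_i) / 2`. -/
def Simplices.corner (S : Simplices D k) (j : Fin (k + 1)) : Simplices D k :=
  S.inside (fun i => midpoint ℝ (S.1 j) (S.1 i)) fun i => S.midpoint_mem j i

/-- The medial triangle `[q₀ q₁ q₂]` of `[p₀ p₁ p₂]`, where `qᵢ` is the midpoint of the side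
opposite to `pᵢ`. -/
def Simplices.medial (S : Simplices D 2) : Simplices D 2 :=
  S.inside
    ![midpoint ℝ (S.1 1) (S.1 2), midpoint ℝ (S.1 0) (S.1 2), midpoint ℝ (S.1 0) (S.1 1)] (by
      intro i
      fin_cases i
      · exact S.midpoint_mem 1 2
      · exact S.midpoint_mem 0 2
      · exact S.midpoint_mem 0 1)

/-- `(dya' ω)_S = ⟨dya S, ω⟩`, the sum of `ω` over the dyadic decomposition of `S` (which is used
for `k = 1, 2` only): `dya [p₀ p₁] = [p₀ q] + [q p₁]` with `q = (p₀ + p₁) / 2`, and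
`dya [p₀ p₁ p₂] = [p₀ q₂ q₁] + [q₂ p₁ q₀] + [q₁ q₀ p₂] + [q₀ q₁ q₂]`. -/
def dyadic : {k : ℕ} → Germ D k → Germ D k
  | 2, ω => fun S => (∑ j, ω (S.corner j)) + ω S.medial
  | _, ω => fun S => ∑ j, ω (S.corner j)

/-- The dyadic sum `⟨dyaⁿ S, ω⟩`. -/
def dyadicSum (n : ℕ) (ω : Germ D k) : Germ D k :=
  dyadic^[n] ω

/-- `η` is a sewing of `ω` with respect to `v`: it is regular and `ω ≈_v η`. The germ `ω` is
`v`-sewable, `v` being a `k`-Dini gauge, if such an `η` exists, and `η` is then denoted `sew ω`. -/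
def IsSewing (v ω η : Germ D k) : Prop :=
  IsRegular η ∧ Near v ω η

end Operations

end

end RoughForm

/-! For nonatomic `ω`, one dyadic subdivision changes `ω` by a fixed signed sum of values of `δω` at
simplices inside `S` (`exists_dyadic_sub_eq`). Hence `|dya ω - ω| ≤ c U`, where `U` is the sum of
`u` over these simplices. Since `dyaⁿ S` consists of `2^{kn}` simplices isometric to `2⁻ⁿ S`,
consecutive dyadic sums differ by at most `c 2^{nk} U(2⁻ⁿ S)`. By the strong Dini condition these
bounds are summable, so the limit `η` exists and lies within `c Ũ` of `ω`, and `v = Ũ` is the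
required gauge. The limit is continuous and dyadically additive (`exists_limit`), and it is
nonatomic because every dyadic sum is.

The difficulty is closedness on planes, because dyadic additivity only speaks of midpoints. The tool
is `Small.eq_zero`: a function that is `o(2^{-kn})` on copies of size `2⁻ⁿ` of a shape, and that is
the sum of its values on at most `2^k` half-size copies, must vanish. The coboundary of `η` has this
decay, since `δω` is dominated by `u` and `ω - η` by `v`. An identity for `η` therefore follows once
its defect is written both as a combination of coboundaries and as a sum over half-size copies of
itself.

For `k = 1` this gives antisymmetry and additivity over equal subsegments; continuity extends the
latter to arbitrary subdivisions. For `k = 2` the chain is: alternation, additivity of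
parallelograms along a side (`par_add`), invariance under shearing (`shear`), and additivity when a
triangle is cut through a vertex (`cut`). By Radon's theorem four coplanar points form either a
triangle with a point inside or a quadrilateral with crossing diagonals, and in both cases cutting
shows that the coboundary vanishes.

Uniqueness uses the same decay: two sewings differ by a dyadically additive germ dominated by a Dini
gauge, which is zero. -/

namespace RoughForm

/-! ### A vanishing principle for self-similar functions -/

section Vanishing

variable {E W W' : Type*} [AddCommGroup W] [Module ℝ W] [AddCommGroup W'] [Module ℝ W']

/-- `f`, a function of a base point and a shape, is `o(r⁻ⁿ)` on all copies of a shape scaled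
by `±2⁻ⁿ`. -/
def Small (r : ℕ) (dom : E → W → Prop) (f : E → W → ℝ) : Prop :=
  ∀ p V, dom p V → ∃ g : ℕ → ℝ, Tendsto g atTop (𝓝 0) ∧
    ∀ (n : ℕ) (s : ℝ) (q : E), |s| = (1 / 2) ^ n → dom q (s • V) →
      (r : ℝ) ^ n * |f q (s • V)| ≤ g n

theorem Small.mono {r : ℕ} {dom dom' : E → W → Prop} {f f' : E → W → ℝ} (hf : Small r dom f)
    (hd : ∀ p V, dom' p V → dom p V) (hf' : ∀ p V, dom' p V → f' p V = f p V) :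
    Small r dom' f' := by
  intro p V h
  obtain ⟨g, hg, H⟩ := hf p V (hd p V h)
  refine ⟨g, hg, fun n s q hs hq => ?_⟩
  rw [hf' _ _ hq]
  exact H n s q hs (hd _ _ hq)

theorem Small.add {r : ℕ} {dom : E → W → Prop} {f f' : E → W → ℝ} (hf : Small r dom f)
    (hf' : Small r dom f') : Small r dom (fun p V => f p V + f' p V) := by
  intro p V h
  obtain ⟨g, hg, H⟩ := hf p V h
  obtain ⟨g', hg', H'⟩ := hf' p V h
  refine ⟨fun n => g n + g' n, by simpa using hg.add hg', fun n s q hs hq => ?_⟩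
  calc (r : ℝ) ^ n * |f q (s • V) + f' q (s • V)|
      ≤ (r : ℝ) ^ n * (|f q (s • V)| + |f' q (s • V)|) := by
        gcongr
        exact abs_add_le _ _
    _ = (r : ℝ) ^ n * |f q (s • V)| + (r : ℝ) ^ n * |f' q (s • V)| := mul_add _ _ _
    _ ≤ g n + g' n := add_le_add (H n s q hs hq) (H' n s q hs hq)

theorem Small.neg {r : ℕ} {dom : E → W → Prop} {f : E → W → ℝ} (hf : Small r dom f) :
    Small r dom (fun p V => -f p V) := by
  intro p V h
  obtain ⟨g, hg, H⟩ := hf p V h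
  exact ⟨g, hg, fun n s q hs hq => by rw [abs_neg]; exact H n s q hs hq⟩

theorem Small.zero (r : ℕ) (dom : E → W → Prop) : Small r dom (fun _ _ => 0) :=
  fun _ _ _ => ⟨fun _ => 0, tendsto_const_nhds, by simp⟩

theorem Small.comp_linear {r : ℕ} {dom : E → W → Prop} {f : E → W → ℝ} (hf : Small r dom f)
    (L : W' →ₗ[ℝ] W) {dom' : E → W' → Prop} (hd : ∀ p V, dom' p V → dom p (L V)) :
    Small r dom' (fun p V => f p (L V)) := by
  intro p V h
  obtain ⟨g, hg, H⟩ := hf p (L V) (hd p V h)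
  refine ⟨g, hg, fun n s q hs hq => ?_⟩
  have := hd _ _ hq
  rw [map_smul] at this
  simpa only [map_smul] using H n s q hs this

/-- A small function that is the sum of its values on at most `r` half-size copies vanishes. -/
theorem Small.eq_zero {r : ℕ} (hr : 0 < r) {dom : E → W → Prop} {f : E → W → ℝ}
    (hf : Small r dom f)
    (step : ∀ p V, dom p V → ∃ l : List (E × ℝ), l.length ≤ r ∧
      (∀ c ∈ l, |c.2| = 1 / 2 ∧ dom c.1 (c.2 • V)) ∧
      f p V = (l.map fun c => f c.1 (c.2 • V)).sum) {p : E} {V : W} (h : dom p V) :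
    f p V = 0 := by
  have hr' : (0 : ℝ) < r := by exact_mod_cast hr
  -- A bound at scale `2⁻ⁿ` is carried up to scale `1`: each of the at most `r` pieces contributes
  -- `B / r`. The base point and the shape must vary in the induction.
  have claim : ∀ (n : ℕ) (p : E) (V : W) (B : ℝ), 0 ≤ B → dom p V →
      (∀ (s : ℝ) (q : E), |s| = (1 / 2) ^ n → dom q (s • V) →
        (r : ℝ) ^ n * |f q (s • V)| ≤ B) → |f p V| ≤ B := by
    intro n
    induction n with
    | zero =>
      intro p V B _ h H
      simpa using H 1 p (by simp) (by simpa using h)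
    | succ n ih =>
      intro p V B hB h H
      obtain ⟨l, hl, hc, e⟩ := step p V h
      have key : ∀ c ∈ l, |f c.1 (c.2 • V)| ≤ B / r := by
        intro c hcl
        refine ih _ _ _ (by positivity) (hc c hcl).2 fun s q hs hq => ?_
        rw [smul_smul] at hq ⊢
        have := H (s * c.2) q (by rw [abs_mul, hs, (hc c hcl).1, pow_succ]) hq
        rw [le_div_iff₀ hr']
        calc _ = (r : ℝ) ^ (n + 1) * |f q ((s * c.2) • V)| := by ring
          _ ≤ B := this
      have hsum : ∀ l : List (E × ℝ), (∀ c ∈ l, |f c.1 (c.2 • V)| ≤ B / r) →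
          |(l.map fun c => f c.1 (c.2 • V)).sum| ≤ l.length * (B / r) := by
        intro l
        induction l with
        | nil => simp
        | cons c l ihl =>
          intro hl
          simp only [List.map_cons, List.sum_cons, List.length_cons, Nat.cast_add, Nat.cast_one]
          have h1 := hl c (by simp)
          have h2 := ihl fun c hc => hl c (by simp [hc])
          have h3 := abs_add_le (f c.1 (c.2 • V)) (l.map fun c => f c.1 (c.2 • V)).sum
          linarith
      rw [e]
      refine (hsum l key).trans ?_
      have : (l.length : ℝ) ≤ r := by exact_mod_cast hl
      calc (l.length : ℝ) * (B / r) ≤ r * (B / r) := by gcongr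
        _ = B := by field_simp
  obtain ⟨g, hg, H⟩ := hf p V h
  have hle : ∀ n, |f p V| ≤ |g n| := fun n =>
    claim n p V _ (abs_nonneg _) h fun s q hs hq => (H n s q hs hq).trans (le_abs_self _)
  have hg0 : Tendsto (fun n => |g n|) atTop (𝓝 0) := by simpa using hg.abs
  exact abs_nonpos_iff.1 (ge_of_tendsto' hg0 hle)

end Vanishing

/-- A function that is continuous on `[0, 1]` and vanishes at rational points vanishes. -/
theorem eq_zero_of_forall_rational {h : ℝ → ℝ} (hc : ContinuousOn h (Set.Icc 0 1))
    (hq : ∀ i j : ℕ, 0 < i + j → h (i / (i + j)) = 0) {t : ℝ} (ht : t ∈ Set.Icc (0 : ℝ) 1) :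
    h t = 0 := by
  set x : ℕ → ℝ := fun n => (⌊t * ((n : ℝ) + 1)⌋₊ : ℝ) / ((n : ℝ) + 1)
  have hle : ∀ n : ℕ, ⌊t * ((n : ℝ) + 1)⌋₊ ≤ n + 1 := fun n => by
    have : t * ((n : ℝ) + 1) ≤ ((n + 1 : ℕ) : ℝ) := by
      push_cast
      nlinarith [ht.2, (Nat.cast_nonneg n : (0 : ℝ) ≤ n)]
    exact (Nat.floor_le_floor this).trans (Nat.floor_natCast _).le
  have hx : ∀ n, x n ∈ Set.Icc (0 : ℝ) 1 := fun n => by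
    refine ⟨by positivity, ?_⟩
    rw [div_le_one (by positivity)]
    exact_mod_cast hle n
  have hx0 : ∀ n, h (x n) = 0 := fun n => by
    obtain ⟨j, hj⟩ := Nat.exists_eq_add_of_le (hle n)
    have := hq ⌊t * ((n : ℝ) + 1)⌋₊ j (by omega)
    have e : (n : ℝ) + 1 = (⌊t * ((n : ℝ) + 1)⌋₊ : ℝ) + j := by exact_mod_cast hj
    rw [← this, ← e]
  have hlim : Tendsto x atTop (𝓝 t) := by
    have h1 := (tendsto_nat_floor_mul_div_atTop (R := ℝ) ht.1).comp
      (tendsto_atTop_add_const_right atTop (1 : ℝ) tendsto_natCast_atTop_atTop)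
    exact h1
  have h2 : Tendsto x atTop (𝓝[Set.Icc 0 1] t) :=
    tendsto_nhdsWithin_iff.2 ⟨hlim, Eventually.of_forall hx⟩
  have h3 := (hc t ht).tendsto.comp h2
  have h4 : h ∘ x = fun _ => 0 := funext hx0
  rw [h4] at h3
  exact (tendsto_nhds_unique h3 tendsto_const_nhds)

/-- The same `2n` terms are grouped into two halves and into consecutive pairs. This compares
halving a whole row of `n` pieces with halving each piece. -/
theorem sum_range_two_mul_eq (n : ℕ) (f : ℕ → ℝ) :
    ∑ i ∈ Finset.range n, f i + ∑ i ∈ Finset.range n, f (n + i) =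
      ∑ i ∈ Finset.range n, (f (2 * i) + f (2 * i + 1)) := by
  rw [← Finset.sum_range_add, ← two_mul]
  induction n with
  | zero => simp
  | succ n ih =>
    rw [show 2 * (n + 1) = 2 * n + 1 + 1 by ring, Finset.sum_range_succ, Finset.sum_range_succ, ih,
      Finset.sum_range_succ]
    ring

theorem _root_.Convex.mem_of_line {E : Type*} [AddCommGroup E] [Module ℝ E] {K : Set E}
    (hK : Convex ℝ K) {p e q : E} {x y z : ℝ} (hx : p + x • e ∈ K) (hy : p + y • e ∈ K)
    (hxz : x ≤ z) (hzy : z ≤ y) (hq : q = p + z • e) : q ∈ K := by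
  rcases hxz.eq_or_lt with rfl | hxz
  · rwa [hq]
  have hxy : 0 < y - x := by linarith
  have := hK hx hy (a := (y - z) / (y - x)) (b := (z - x) / (y - x))
    (div_nonneg (by linarith) hxy.le) (div_nonneg (by linarith) hxy.le)
    (by field_simp; ring)
  convert this using 1
  rw [hq]
  match_scalars <;> field_simp <;> ring

/-! ### Sewn 1-germs: from midpoint additivity to additivity -/

section Segments

variable {E : Type*} [NormedAddCommGroup E] [NormedSpace ℝ E]

/-- The abstract properties, on a convex set, of a sewn `1`-germ. -/
structure SewnSegments (K : Set E) (N : E → E → ℝ) : Prop where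
  convex : Convex ℝ K
  degenerate : ∀ a ∈ K, N a a = 0
  dyadic : ∀ a ∈ K, ∀ b ∈ K, ∀ z, z = (1 / 2 : ℝ) • (a + b) → N a b = N a z + N z b
  small : Small 2 (fun p (V : Fin 3 → E) => ∀ i, p + V i ∈ K)
    fun p V => N (p + V 1) (p + V 2) - N (p + V 0) (p + V 2) + N (p + V 0) (p + V 1)
  continuousOn : ContinuousOn (fun x : E × E => N x.1 x.2) (K ×ˢ K)

namespace SewnSegments

variable {K : Set E} {N : E → E → ℝ}

theorem delta_small (h : SewnSegments K N) {dom : E → E → Prop} (x y z : ℝ)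
    (hd : ∀ p e, dom p e → p + x • e ∈ K ∧ p + y • e ∈ K ∧ p + z • e ∈ K) :
    Small 2 dom fun p e => N (p + y • e) (p + z • e) - N (p + x • e) (p + z • e)
      + N (p + x • e) (p + y • e) := by
  have := h.small.comp_linear (W' := E) (LinearMap.pi fun i => (![x, y, z] i) • LinearMap.id)
    (dom' := dom) (fun p V hV i => by
      obtain ⟨h0, h1, h2⟩ := hd p V hV
      fin_cases i <;> simpa)
  simpa using this

/-- The sum `N a b + N b a` is the coboundary at the degenerate triple `a, b, a`, hence small, and
it is additive under bisection. -/
theorem antisymm (h : SewnSegments K N) {a b : E} (ha : a ∈ K) (hb : b ∈ K) :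
    N b a = -N a b := by
  have key : Small 2 (fun p e : E => p ∈ K ∧ p + e ∈ K) fun p e => N p (p + e) + N (p + e) p := by
    refine (h.delta_small 0 1 0 (dom := fun p e : E => p ∈ K ∧ p + e ∈ K) fun p e hpe => ?_).mono
      (fun _ _ h => h) fun p e hpe => ?_
    · simpa using ⟨hpe.1, hpe.2, hpe.1⟩
    · have := h.degenerate p hpe.1
      simp only [zero_smul, one_smul, add_zero, this]
      ring
  have h0 := key.eq_zero two_pos (p := a) (V := b - a) (fun p e ⟨hp, he⟩ => ?_) (by simpa using ⟨ha, hb⟩)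
  · simp only [add_sub_cancel] at h0
    linarith
  have hm : p + (1 / 2 : ℝ) • e ∈ K := h.convex.mem_of_line (p := p) (e := e) (x := 0) (y := 1) (z := 1 / 2)
    (by simpa) (by simpa) (by norm_num) (by norm_num) rfl
  refine ⟨[(p, 1 / 2), (p + (1 / 2 : ℝ) • e, 1 / 2)], by simp, ?_, ?_⟩
  · have e1 : p + (1 / 2 : ℝ) • e + (1 / 2 : ℝ) • e = p + e := by module
    intro c hc
    simp only [List.mem_cons, List.not_mem_nil, or_false] at hc
    rcases hc with rfl | rfl
    · exact ⟨by norm_num [abs_of_pos], hp, hm⟩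
    · exact ⟨by norm_num [abs_of_pos], hm, by simpa only [e1]⟩
  · have e1 : p + (1 / 2 : ℝ) • e + (1 / 2 : ℝ) • e = p + e := by module
    simp only [List.map_cons, List.map_nil, List.sum_cons, List.sum_nil, e1]
    have h1 := h.dyadic p hp (p + e) he (p + (1 / 2 : ℝ) • e) (by module)
    have h2 := h.dyadic (p + e) he p hp (p + (1 / 2 : ℝ) • e) (by module)
    linarith

/-- For fixed `j` the defect is a sum of `j` coboundaries, hence small. Bisecting both the long
segment and the `j` short ones produces the same defect, with the same `j`, on the two halves. -/
theorem eq_sum (h : SewnSegments K N) (j : ℕ) {p e : E} (hp : p ∈ K) (he : p + (j : ℝ) • e ∈ K) :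
    N p (p + (j : ℝ) • e) =
      ∑ i ∈ Finset.range j, N (p + (i : ℝ) • e) (p + ((i : ℝ) + 1) • e) := by
  set F : ℕ → E → E → ℝ := fun j p e => N p (p + (j : ℝ) • e) -
    ∑ i ∈ Finset.range j, N (p + (i : ℝ) • e) (p + ((i : ℝ) + 1) • e) with hF
  have key : ∀ j : ℕ, Small 2 (fun p e : E => p ∈ K ∧ p + (j : ℝ) • e ∈ K) (F j) := by
    intro j
    induction j with
    | zero =>
      refine (Small.zero 2 _).mono (fun _ _ h => h) fun p e hpe => ?_
      simp [hF, h.degenerate p hpe.1]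
    | succ j ih =>
      have hmem : ∀ p e : E, p ∈ K ∧ p + ((j + 1 : ℕ) : ℝ) • e ∈ K → p + (j : ℝ) • e ∈ K := by
        rintro p e ⟨hp, he⟩
        exact h.convex.mem_of_line (p := p) (e := e) (x := 0) (y := ((j + 1 : ℕ) : ℝ)) (z := j) (by simpa) he
          (by positivity) (by simp) rfl
      refine ((ih.mono (dom' := fun p e : E => p ∈ K ∧ p + ((j + 1 : ℕ) : ℝ) • e ∈ K)
        (fun p e hpe => ⟨hpe.1, hmem p e hpe⟩) fun _ _ _ => rfl).add
        ((h.delta_small 0 j ((j + 1 : ℕ) : ℝ) fun p e hpe => ⟨by simpa using hpe.1, hmem p e hpe,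
          hpe.2⟩).neg)).mono (fun _ _ h => h) fun p e hpe => ?_
      simp only [hF, Finset.sum_range_succ, zero_smul, add_zero, Nat.cast_add, Nat.cast_one]
      ring
  have h0 := (key j).eq_zero two_pos (p := p) (V := e) (fun p e ⟨hp, he⟩ => ?_) ⟨hp, he⟩
  · simp only [hF] at h0
    linarith
  have hm : p + ((j : ℝ) / 2) • e ∈ K := h.convex.mem_of_line (p := p) (e := e) (x := 0) (y := j) (z := (j : ℝ) / 2)
    (by simpa) he (by positivity) (by linarith [(Nat.cast_nonneg j : (0 : ℝ) ≤ j)]) rfl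
  have e1 : p + (j : ℝ) • (1 / 2 : ℝ) • e = p + ((j : ℝ) / 2) • e := by module
  have e2 : p + ((j : ℝ) / 2) • e + (j : ℝ) • (1 / 2 : ℝ) • e = p + (j : ℝ) • e := by module
  refine ⟨[(p, 1 / 2), (p + ((j : ℝ) / 2) • e, 1 / 2)], by simp, ?_, ?_⟩
  · intro c hc
    simp only [List.mem_cons, List.not_mem_nil, or_false] at hc
    rcases hc with rfl | rfl
    · exact ⟨by norm_num [abs_of_pos], hp, by simpa only [e1]⟩
    · exact ⟨by norm_num [abs_of_pos], hm, by simpa only [e2]⟩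
  · simp only [List.map_cons, List.map_nil, List.sum_cons, List.sum_nil, hF, e1, e2]
    have h1 := h.dyadic p hp _ he (p + ((j : ℝ) / 2) • e) (by module)
    -- The `2j` bisected short segments are regrouped into those of the first and those of the
    -- second half.
    have h2 := sum_range_two_mul_eq j fun i =>
      N (p + ((i : ℝ) / 2) • e) (p + (((i : ℝ) + 1) / 2) • e)
    have h3 : ∀ i ∈ Finset.range j, N (p + (i : ℝ) • e) (p + ((i : ℝ) + 1) • e) =
        N (p + (((2 * i : ℕ) : ℝ) / 2) • e) (p + ((((2 * i : ℕ) : ℝ) + 1) / 2) • e) +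
        N (p + (((2 * i + 1 : ℕ) : ℝ) / 2) • e) (p + ((((2 * i + 1 : ℕ) : ℝ) + 1) / 2) • e) := by
      intro i hi
      have hij : ((i : ℝ) + 1) ≤ j := by exact_mod_cast Finset.mem_range.1 hi
      have hi0 : (0 : ℝ) ≤ i := Nat.cast_nonneg i
      have := h.dyadic (p + (i : ℝ) • e)
        (h.convex.mem_of_line (p := p) (e := e) (x := 0) (y := j) (by simpa) he hi0 (by linarith) rfl)
        (p + ((i : ℝ) + 1) • e)
        (h.convex.mem_of_line (p := p) (e := e) (x := 0) (y := j) (by simpa) he (by linarith) hij rfl)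
        (p + ((2 * (i : ℝ) + 1) / 2) • e) (by module)
      rw [this]
      push_cast
      congr 2 <;> module
    rw [Finset.sum_congr rfl h3, ← h2, h1]
    have h4 : ∀ i : ℕ, N (p + (i : ℝ) • (1 / 2 : ℝ) • e) (p + ((i : ℝ) + 1) • (1 / 2 : ℝ) • e) =
        N (p + ((i : ℝ) / 2) • e) (p + (((i : ℝ) + 1) / 2) • e) := fun i => by
      congr 1 <;> module
    have h5 : ∀ i : ℕ, N (p + ((j : ℝ) / 2) • e + (i : ℝ) • (1 / 2 : ℝ) • e)
        (p + ((j : ℝ) / 2) • e + ((i : ℝ) + 1) • (1 / 2 : ℝ) • e) =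
        N (p + (((j + i : ℕ) : ℝ) / 2) • e) (p + ((((j + i : ℕ) : ℝ) + 1) / 2) • e) := fun i => by
      push_cast
      congr 1 <;> module
    rw [Finset.sum_congr rfl fun i _ => h4 i, Finset.sum_congr rfl fun i _ => h5 i]
    ring

theorem additive_nat (h : SewnSegments K N) (i j : ℕ) {p e : E} (hp : p ∈ K)
    (he : p + ((i : ℝ) + j) • e ∈ K) :
    N p (p + ((i : ℝ) + j) • e) = N p (p + (i : ℝ) • e) + N (p + (i : ℝ) • e)
      (p + ((i : ℝ) + j) • e) := by
  have hi : p + (i : ℝ) • e ∈ K := h.convex.mem_of_line (p := p) (e := e) (x := 0) (y := (i : ℝ) + j) (by simpa) he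
    (by positivity) (by simp) rfl
  have e1 : p + (i : ℝ) • e + (j : ℝ) • e = p + ((i : ℝ) + j) • e := by module
  have h1 := h.eq_sum (i + j) (p := p) (e := e) hp (by simpa using he)
  have h2 := h.eq_sum i hp hi
  have h3 := h.eq_sum j hi (by rwa [e1])
  rw [e1] at h3
  push_cast at h1
  rw [h1, h2, h3, Finset.sum_range_add]
  congr 1
  refine Finset.sum_congr rfl fun l _ => ?_
  push_cast
  congr 1 <;> module

/-- A rational ratio `i / (i + j)` is the case of `i + j` equal pieces; continuity gives the other
ratios. -/
theorem additive_of_mem_segment (h : SewnSegments K N) {a b c : E} (ha : a ∈ K) (hc : c ∈ K)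
    (hb : b ∈ segment ℝ a c) : N a c = N a b + N b c := by
  rw [segment_eq_image_lineMap] at hb
  obtain ⟨t, ht, rfl⟩ := hb
  have hmem : ∀ s ∈ Set.Icc (0 : ℝ) 1, AffineMap.lineMap a c s ∈ K := fun s hs =>
    h.convex.lineMap_mem ha hc hs
  have hcont : Continuous fun s : ℝ => AffineMap.lineMap a c s :=
    AffineMap.lineMap_continuous
  refine sub_eq_zero.1 (eq_zero_of_forall_rational (h := fun s => N a c - (N a (AffineMap.lineMap a c s)
    + N (AffineMap.lineMap a c s) c)) ?_ ?_ ht)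
  · refine continuousOn_const.sub (ContinuousOn.add ?_ ?_)
    · exact h.continuousOn.comp (continuous_const.prodMk hcont).continuousOn fun s hs =>
        ⟨ha, hmem s hs⟩
    · exact h.continuousOn.comp (hcont.prodMk continuous_const).continuousOn fun s hs =>
        ⟨hmem s hs, hc⟩
  · intro i j hij
    have hij' : (0 : ℝ) < (i : ℝ) + j := by exact_mod_cast hij
    have e1 : a + ((i : ℝ) + j) • (((i : ℝ) + j)⁻¹ • (c - a)) = c := by
      rw [smul_smul, mul_inv_cancel₀ hij'.ne']; module
    have e2 : a + (i : ℝ) • (((i : ℝ) + j)⁻¹ • (c - a)) =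
        AffineMap.lineMap a c ((i : ℝ) / (i + j)) := by
      rw [AffineMap.lineMap_apply_module', div_eq_mul_inv, smul_smul, add_comm]
    have := h.additive_nat i j (p := a) (e := ((i : ℝ) + j)⁻¹ • (c - a)) ha (by rwa [e1])
    rw [e1, e2] at this
    linarith

theorem closed (h : SewnSegments K N) {a b c : E} (ha : a ∈ K) (hb : b ∈ K) (hc : c ∈ K)
    (hcol : Collinear ℝ {a, b, c}) : N b c - N a c + N a b = 0 := by
  rcases hcol.wbtw_or_wbtw_or_wbtw with H | H | H <;> rw [← mem_segment_iff_wbtw] at H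
  · linarith [h.additive_of_mem_segment ha hc H]
  · linarith [h.additive_of_mem_segment hb ha H, h.antisymm ha hb, h.antisymm ha hc]
  · linarith [h.additive_of_mem_segment hc hb H, h.antisymm hc ha, h.antisymm hb hc]

end SewnSegments

end Segments


/-! ### Points of parallelograms and triangles in a convex set -/

section Membership

variable {E : Type*} [AddCommGroup E] [Module ℝ E] {K : Set E}

theorem _root_.Convex.mem_of_parallelogram (hK : Convex ℝ K) {p f e q : E} {x y : ℝ} (hp : p ∈ K)
    (hf : p + f ∈ K) (he : p + e ∈ K) (hfe : p + f + e ∈ K) (hx : 0 ≤ x) (hx' : x ≤ 1)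
    (hy : 0 ≤ y) (hy' : y ≤ 1) (hq : q = p + x • f + y • e) : q ∈ K := by
  have h1 : p + x • f ∈ K := hK.mem_of_line (p := p) (e := f) (x := 0) (y := 1) (by simpa)
    (by simpa) hx hx' rfl
  have h2 : p + x • f + e ∈ K := hK.mem_of_line (p := p + e) (e := f) (x := 0) (y := 1) (by simpa)
    (by convert hfe using 1; module) hx hx' (by module)
  exact hK.mem_of_line (p := p + x • f) (e := e) (x := 0) (y := 1) (by simpa) (by simpa) hy hy' hq

theorem _root_.Convex.mem_of_triangle (hK : Convex ℝ K) {p f e q : E} {x y : ℝ} (hp : p ∈ K)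
    (hf : p + f ∈ K) (he : p + e ∈ K) (hx : 0 ≤ x) (hy : 0 ≤ y) (hxy : x + y ≤ 1)
    (hq : q = p + x • f + y • e) : q ∈ K := by
  have := hK.sum_mem (t := Finset.univ) (w := ![1 - x - y, x, y]) (z := ![p, p + f, p + e])
    (fun i _ => by fin_cases i <;> simp <;> linarith)
    (by simp only [Fin.sum_univ_three, Matrix.cons_val_zero, Matrix.cons_val_one, Matrix.cons_val]; ring)
    (fun i _ => by fin_cases i <;> simpa)
  convert this using 1
  simp only [Fin.sum_univ_three, Matrix.cons_val_zero, Matrix.cons_val_one, Matrix.cons_val, hq]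
  module

end Membership

section Parallelograms

variable {E : Type*} [AddCommGroup E]

/-- The coboundary of a function of three points. -/
def delta (N : E → E → E → ℝ) (a b c d : E) : ℝ :=
  N b c d - N a c d + N a b d - N a b c

/-- The sum of `N` over the two halves of the parallelogram `p, p + f, p + f + e, p + e`. -/
def par (N : E → E → E → ℝ) (p f e : E) : ℝ :=
  N p (p + f) (p + f + e) + N p (p + f + e) (p + e)

theorem par_eq (N : E → E → E → ℝ) {p f e b c d : E} (hb : p + f = b) (hc : p + f + e = c)
    (hd : p + e = d) : par N p f e = N p b c + N p c d := by
  subst hb hc hd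
  rfl

end Parallelograms

/-! ### Sewn 2-germs: alternation and strips of parallelograms -/

section Triangles

variable {E : Type*} [NormedAddCommGroup E] [NormedSpace ℝ E]

/-- The abstract properties, on a convex set, of a sewn `2`-germ. -/
structure SewnTriangles (K : Set E) (N : E → E → E → ℝ) : Prop where
  convex : Convex ℝ K
  degenerate : ∀ a ∈ K, ∀ b ∈ K, ∀ c ∈ K, ∀ (p w : E) (x y z : ℝ), a = p + x • w → b = p + y • w →
    c = p + z • w → N a b c = 0
  dyadic : ∀ a ∈ K, ∀ b ∈ K, ∀ c ∈ K, ∀ x y z, x = (1 / 2 : ℝ) • (b + c) →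
    y = (1 / 2 : ℝ) • (a + c) → z = (1 / 2 : ℝ) • (a + b) →
    N a b c = N a z y + N z b x + N y x c + N x y z
  small : Small 4 (fun p (V : Fin 4 → E) => ∀ i, p + V i ∈ K)
    fun p V => delta N (p + V 0) (p + V 1) (p + V 2) (p + V 3)
  continuousOn : ContinuousOn (fun x : E × E × E => N x.1 x.2.1 x.2.2) (K ×ˢ K ×ˢ K)

/-- A point with fixed affine coordinates with respect to a moving frame. -/
def IsFramePoint (A : E → E × E → E) : Prop :=
  ∃ x y : ℝ, ∀ p V, A p V = p + (x • V.1 + y • V.2)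

namespace SewnTriangles

variable {K : Set E} {N : E → E → E → ℝ}

theorem delta_small (h : SewnTriangles K N) {dom : E → E × E → Prop} {A B C D : E → E × E → E}
    (hA : IsFramePoint A) (hB : IsFramePoint B) (hC : IsFramePoint C) (hD : IsFramePoint D)
    (hd : ∀ p V, dom p V → A p V ∈ K ∧ B p V ∈ K ∧ C p V ∈ K ∧ D p V ∈ K) :
    Small 4 dom fun p V => delta N (A p V) (B p V) (C p V) (D p V) := by
  obtain ⟨x0, y0, h0⟩ := hA
  obtain ⟨x1, y1, h1⟩ := hB
  obtain ⟨x2, y2, h2⟩ := hC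
  obtain ⟨x3, y3, h3⟩ := hD
  simp only [h0, h1, h2, h3] at hd ⊢
  have := h.small.comp_linear (W' := E × E) (LinearMap.pi fun i =>
    (![x0, x1, x2, x3] i) • LinearMap.fst ℝ E E + (![y0, y1, y2, y3] i) • LinearMap.snd ℝ E E)
    (dom' := dom) (fun p V hV i => by
      obtain ⟨h0, h1, h2, h3⟩ := hd p V hV
      fin_cases i <;> simpa)
  simpa using this

theorem degenerate_left (h : SewnTriangles K N) {a b : E} (ha : a ∈ K) (hb : b ∈ K) :
    N a a b = 0 :=
  h.degenerate a ha a ha b hb a (b - a) 0 0 1 (by module) (by module) (by module)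

theorem degenerate_right (h : SewnTriangles K N) {a b : E} (ha : a ∈ K) (hb : b ∈ K) :
    N a b b = 0 :=
  h.degenerate a ha b hb b hb a (b - a) 0 1 1 (by module) (by module) (by module)

theorem degenerate_outer (h : SewnTriangles K N) {a b : E} (ha : a ∈ K) (hb : b ∈ K) :
    N a b a = 0 :=
  h.degenerate a ha b hb a ha a (b - a) 0 1 0 (by module) (by module) (by module)

/-- A dyadically additive combination of the values of `N` at a triangle with permuted vertices
vanishes if it is small. -/
theorem eq_zero_of_dyadic (h : SewnTriangles K N) {A : E → E → E → ℝ}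
    (hs : Small 4 (fun p (V : E × E) => p ∈ K ∧ p + V.1 ∈ K ∧ p + V.2 ∈ K)
      fun p V => A p (p + V.1) (p + V.2))
    (hA : ∀ a ∈ K, ∀ b ∈ K, ∀ c ∈ K, ∀ x y z, x = (1 / 2 : ℝ) • (b + c) →
      y = (1 / 2 : ℝ) • (a + c) → z = (1 / 2 : ℝ) • (a + b) →
      A a b c = A a z y + A z b x + A y x c + A x y z)
    {a b c : E} (ha : a ∈ K) (hb : b ∈ K) (hc : c ∈ K) : A a b c = 0 := by
  have h0 := hs.eq_zero (by norm_num) (p := a) (V := (b - a, c - a)) (fun p V ⟨hp, hf, he⟩ => ?_)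
    (by simpa using ⟨ha, hb, hc⟩)
  · simpa using h0
  have hz : p + (1 / 2 : ℝ) • V.1 ∈ K := h.convex.mem_of_triangle (x := 1 / 2) (y := 0) hp hf he
    (by norm_num) (by norm_num) (by norm_num) (by module)
  have hy : p + (1 / 2 : ℝ) • V.2 ∈ K := h.convex.mem_of_triangle (x := 0) (y := 1 / 2) hp hf he
    (by norm_num) (by norm_num) (by norm_num) (by module)
  have hx : p + (1 / 2 : ℝ) • (V.1 + V.2) ∈ K := h.convex.mem_of_triangle (x := 1 / 2)
    (y := 1 / 2) hp hf he (by norm_num) (by norm_num) (by norm_num) (by module)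
  have e1 : p + (1 / 2 : ℝ) • V.1 + (1 / 2 : ℝ) • V.1 = p + V.1 := by module
  have e2 : p + (1 / 2 : ℝ) • V.1 + (1 / 2 : ℝ) • V.2 = p + (1 / 2 : ℝ) • (V.1 + V.2) := by module
  have e3 : p + (1 / 2 : ℝ) • V.2 + (1 / 2 : ℝ) • V.1 = p + (1 / 2 : ℝ) • (V.1 + V.2) := by module
  have e4 : p + (1 / 2 : ℝ) • V.2 + (1 / 2 : ℝ) • V.2 = p + V.2 := by module
  have e5 : p + (1 / 2 : ℝ) • (V.1 + V.2) + (-(1 / 2) : ℝ) • V.1 = p + (1 / 2 : ℝ) • V.2 := by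
    module
  have e6 : p + (1 / 2 : ℝ) • (V.1 + V.2) + (-(1 / 2) : ℝ) • V.2 = p + (1 / 2 : ℝ) • V.1 := by
    module
  -- Three corner triangles and the medial one. The medial triangle is a reflected copy, which is
  -- why scale factors of either sign are allowed in `Small`.
  refine ⟨[(p, 1 / 2), (p + (1 / 2 : ℝ) • V.1, 1 / 2), (p + (1 / 2 : ℝ) • V.2, 1 / 2),
    (p + (1 / 2 : ℝ) • (V.1 + V.2), -(1 / 2))], by simp, ?_, ?_⟩
  · simp only [List.forall_mem_cons, List.not_mem_nil, false_imp_iff, implies_true, and_true,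
      Prod.smul_fst, Prod.smul_snd, e1, e2, e3, e4, e5, e6]
    refine ⟨⟨?_, hp, hz, hy⟩, ⟨?_, hz, hf, hx⟩, ⟨?_, hy, hx, he⟩, ⟨?_, hx, hy, hz⟩⟩ <;>
      norm_num [abs_of_pos]
  · simp only [List.map_cons, List.map_nil, List.sum_cons, List.sum_nil,
      Prod.smul_fst, Prod.smul_snd, e1, e2, e3, e4, e5, e6]
    rw [hA p hp _ hf _ he (p + (1 / 2 : ℝ) • (V.1 + V.2)) (p + (1 / 2 : ℝ) • V.2)
      (p + (1 / 2 : ℝ) • V.1) (by module) (by module) (by module)]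
    ring

/-- Up to degenerate terms the defect is the coboundary at `a, b, a, c`. -/
theorem antisymm_left (h : SewnTriangles K N) {a b c : E} (ha : a ∈ K) (hb : b ∈ K) (hc : c ∈ K) :
    N b a c = -N a b c := by
  suffices N a b c + N b a c = 0 by linarith
  refine h.eq_zero_of_dyadic (A := fun a b c => N a b c + N b a c) ?_ ?_ ha hb hc
  · refine (h.delta_small (A := fun p _ => p) (B := fun p V => p + V.1) (C := fun p _ => p)
      (D := fun p V => p + V.2) ⟨0, 0, fun p V => by module⟩ ⟨1, 0, fun p V => by module⟩
      ⟨0, 0, fun p V => by module⟩ ⟨0, 1, fun p V => by module⟩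
      fun p V ⟨h0, h1, h2⟩ => ⟨h0, h1, h0, h2⟩).mono (fun _ _ h => h) fun p V ⟨h0, h1, h2⟩ => ?_
    simp only [delta, h.degenerate_left h0 h2, h.degenerate_outer h0 h1]
    ring
  · intro a ha b hb c hc x y z hx hy hz
    have h1 := h.dyadic a ha b hb c hc x y z hx hy hz
    have h2 := h.dyadic b hb a ha c hc y x z hy hx (by rw [hz, add_comm])
    linarith

/-- Up to degenerate terms and sign the defect is the coboundary at `a, b, c, b`. -/
theorem antisymm_right (h : SewnTriangles K N) {a b c : E} (ha : a ∈ K) (hb : b ∈ K) (hc : c ∈ K) :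
    N a c b = -N a b c := by
  suffices N a b c + N a c b = 0 by linarith
  refine h.eq_zero_of_dyadic (A := fun a b c => N a b c + N a c b) ?_ ?_ ha hb hc
  · refine (h.delta_small (A := fun p _ => p) (B := fun p V => p + V.1) (C := fun p V => p + V.2)
      (D := fun p V => p + V.1) ⟨0, 0, fun p V => by module⟩ ⟨1, 0, fun p V => by module⟩
      ⟨0, 1, fun p V => by module⟩ ⟨1, 0, fun p V => by module⟩
      fun p V ⟨h0, h1, h2⟩ => ⟨h0, h1, h2, h1⟩).neg.mono (fun _ _ h => h) fun p V ⟨h0, h1, h2⟩ => ?_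
    simp only [delta, h.degenerate_right h0 h1, h.degenerate_outer h1 h2]
    ring
  · intro a ha b hb c hc x y z hx hy hz
    have h1 := h.dyadic a ha b hb c hc x y z hx hy hz
    have h2 := h.dyadic a ha c hc b hb x z y (by rw [hx, add_comm]) hz hy
    linarith

theorem cyclic (h : SewnTriangles K N) {a b c : E} (ha : a ∈ K) (hb : b ∈ K) (hc : c ∈ K) :
    N b c a = N a b c := by
  rw [h.antisymm_right hb ha hc, h.antisymm_left ha hb hc, neg_neg]

/-- The eight dyadic pieces of the two halves pair up to four half-size parallelograms, once the two
medial triangles are rotated cyclically. -/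
theorem par_split (h : SewnTriangles K N) {p f e : E} (hp : p ∈ K) (hf : p + f ∈ K)
    (he : p + e ∈ K) (hfe : p + f + e ∈ K) {f' e' : E} (hf' : f' = (1 / 2 : ℝ) • f)
    (he' : e' = (1 / 2 : ℝ) • e) :
    par N p f e = par N p f' e' + par N (p + f') f' e' + par N (p + e') f' e' +
      par N (p + f' + e') f' e' := by
  subst hf' he'
  have hb : p + (1 / 2 : ℝ) • f ∈ K := h.convex.mem_of_parallelogram (x := 1 / 2) (y := 0) hp hf he
    hfe (by norm_num) (by norm_num) (by norm_num) (by norm_num) (by module)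
  have hd : p + (1 / 2 : ℝ) • e ∈ K := h.convex.mem_of_parallelogram (x := 0) (y := 1 / 2) hp hf he
    hfe (by norm_num) (by norm_num) (by norm_num) (by norm_num) (by module)
  have ho : p + (1 / 2 : ℝ) • f + (1 / 2 : ℝ) • e ∈ K := h.convex.mem_of_parallelogram
    (x := 1 / 2) (y := 1 / 2) hp hf he
    hfe (by norm_num) (by norm_num) (by norm_num) (by norm_num) (by module)
  have hb' : p + f + (1 / 2 : ℝ) • e ∈ K := h.convex.mem_of_parallelogram
    (x := 1) (y := 1 / 2) hp hf he
    hfe (by norm_num) (by norm_num) (by norm_num) (by norm_num) (by module)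
  have hd' : p + (1 / 2 : ℝ) • f + e ∈ K := h.convex.mem_of_parallelogram
    (x := 1 / 2) (y := 1) hp hf he
    hfe (by norm_num) (by norm_num) (by norm_num) (by norm_num) (by module)
  have h1 := h.dyadic p hp _ hf _ hfe (p + f + (1 / 2 : ℝ) • e)
    (p + (1 / 2 : ℝ) • f + (1 / 2 : ℝ) • e) (p + (1 / 2 : ℝ) • f) (by module) (by module)
    (by module)
  have h2 := h.dyadic p hp _ hfe _ he (p + (1 / 2 : ℝ) • f + e)
    (p + (1 / 2 : ℝ) • e) (p + (1 / 2 : ℝ) • f + (1 / 2 : ℝ) • e) (by module) (by module)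
    (by module)
  have q1 := par_eq N (p := p) (f := (1 / 2 : ℝ) • f) (e := (1 / 2 : ℝ) • e) rfl rfl rfl
  have q2 := par_eq N (p := p + (1 / 2 : ℝ) • f) (f := (1 / 2 : ℝ) • f) (e := (1 / 2 : ℝ) • e)
    (b := p + f) (c := p + f + (1 / 2 : ℝ) • e) (by module) (by module) rfl
  have q3 := par_eq N (p := p + (1 / 2 : ℝ) • e) (f := (1 / 2 : ℝ) • f) (e := (1 / 2 : ℝ) • e)
    (b := p + (1 / 2 : ℝ) • f + (1 / 2 : ℝ) • e) (c := p + (1 / 2 : ℝ) • f + e) (d := p + e)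
    (by module) (by module) (by module)
  have q4 := par_eq N (p := p + (1 / 2 : ℝ) • f + (1 / 2 : ℝ) • e) (f := (1 / 2 : ℝ) • f)
    (e := (1 / 2 : ℝ) • e)
    (b := p + f + (1 / 2 : ℝ) • e) (c := p + f + e) (d := p + (1 / 2 : ℝ) • f + e)
    (by module) (by module) (by module)
  rw [q1, q2, q3, q4, par]
  linarith [h.cyclic hb hb' ho, h.cyclic hd' hd ho]

theorem par_zero (h : SewnTriangles K N) {p f : E} (hp : p ∈ K) (hf : p + f ∈ K) :
    par N p f 0 = 0 := by
  rw [par, add_zero, add_zero, h.degenerate_right hp hf, h.degenerate_outer hp hf, add_zero]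

/-- This is the two-dimensional analogue of `SewnSegments.eq_sum`: the defect of a strip of `j`
cells is small for fixed `j`, and quartering the strip and every cell reproduces it on the four
quarters of the strip. -/
theorem par_eq_sum (h : SewnTriangles K N) (j : ℕ) {p f e : E} (hp : p ∈ K) (hf : p + f ∈ K)
    (he : p + (j : ℝ) • e ∈ K) (hfe : p + f + (j : ℝ) • e ∈ K) :
    par N p f ((j : ℝ) • e) = ∑ i ∈ Finset.range j, par N (p + (i : ℝ) • e) f e := by
  set F : ℕ → E → E × E → ℝ := fun j p V => par N p V.1 ((j : ℝ) • V.2) -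
    ∑ i ∈ Finset.range j, par N (p + (i : ℝ) • V.2) V.1 V.2 with hF
  let dom : ℕ → E → E × E → Prop := fun j p V =>
    p ∈ K ∧ p + V.1 ∈ K ∧ p + (j : ℝ) • V.2 ∈ K ∧ p + V.1 + (j : ℝ) • V.2 ∈ K
  have hmem : ∀ (j : ℕ) (p : E) (V : E × E), dom j p V → ∀ x : ℝ, 0 ≤ x → x ≤ j →
      p + x • V.2 ∈ K ∧ p + V.1 + x • V.2 ∈ K := by
    rintro j p V ⟨h0, h1, h2, h3⟩ x hx hx'
    exact ⟨h.convex.mem_of_line (p := p) (e := V.2) (x := 0) (y := j) (by simpa) h2 hx hx' rfl,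
      h.convex.mem_of_line (p := p + V.1) (e := V.2) (x := 0) (y := j) (by simpa) h3 hx hx' rfl⟩
  have key : ∀ j : ℕ, Small 4 (dom j) (F j) := by
    intro j
    induction j with
    | zero =>
      refine (Small.zero 4 _).mono (fun _ _ h => h) fun p V hV => ?_
      simp only [hF, Finset.range_zero, Finset.sum_empty, Nat.cast_zero, zero_smul,
        h.par_zero hV.1 hV.2.1, sub_zero]
    | succ j ih =>
      have hc : ((j + 1 : ℕ) : ℝ) = (j : ℝ) + 1 := by push_cast; ring
      have hj : ∀ p V, dom (j + 1) p V → p + (j : ℝ) • V.2 ∈ K ∧ p + V.1 + (j : ℝ) • V.2 ∈ K :=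
        fun p V hV => hmem _ p V hV j (by positivity) (by simp)
      -- Appending one cell to the strip costs three coboundaries at flat tetrahedra; the triangles
      -- with all vertices on one side of the strip drop out.
      have s1 := h.delta_small (dom := dom (j + 1)) (A := fun p _ => p) (B := fun p V => p + V.1)
        (C := fun p V => p + V.1 + (j : ℝ) • V.2) (D := fun p V => p + V.1 + ((j : ℝ) + 1) • V.2)
        ⟨0, 0, fun p V => by module⟩ ⟨1, 0, fun p V => by module⟩ ⟨1, j, fun p V => by module⟩
        ⟨1, (j : ℝ) + 1, fun p V => by module⟩
        fun p V hV => ⟨hV.1, hV.2.1, (hj p V hV).2, by simpa using hV.2.2.2⟩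
      have s2 := h.delta_small (dom := dom (j + 1)) (A := fun p _ => p)
        (B := fun p V => p + (j : ℝ) • V.2)
        (C := fun p V => p + V.1 + ((j : ℝ) + 1) • V.2) (D := fun p V => p + ((j : ℝ) + 1) • V.2)
        ⟨0, 0, fun p V => by module⟩ ⟨0, j, fun p V => by module⟩
        ⟨1, (j : ℝ) + 1, fun p V => by module⟩ ⟨0, (j : ℝ) + 1, fun p V => by module⟩
        fun p V hV => ⟨hV.1, (hj p V hV).1, by simpa using hV.2.2.2, by simpa using hV.2.2.1⟩
      have s3 := h.delta_small (dom := dom (j + 1)) (A := fun p _ => p)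
        (B := fun p V => p + (j : ℝ) • V.2) (C := fun p V => p + V.1 + (j : ℝ) • V.2)
        (D := fun p V => p + V.1 + ((j : ℝ) + 1) • V.2)
        ⟨0, 0, fun p V => by module⟩ ⟨0, j, fun p V => by module⟩
        ⟨1, j, fun p V => by module⟩ ⟨1, (j : ℝ) + 1, fun p V => by module⟩
        fun p V hV => ⟨hV.1, (hj p V hV).1, (hj p V hV).2, by simpa using hV.2.2.2⟩
      refine ((((ih.mono (dom' := dom (j + 1)) (fun p V hV => ⟨hV.1, hV.2.1, hj p V hV⟩)
        fun _ _ _ => rfl).add s1).add s2.neg).add s3.neg).mono (fun _ _ h => h) fun p V hV => ?_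
      obtain ⟨hB, hB'⟩ := hj p V hV
      obtain ⟨hA, hA', hC, hC'⟩ := hV
      rw [hc] at hC hC'
      have d1 := h.degenerate _ hA' _ hB' _ hC' (p + V.1) V.2 0 j (j + 1) (by module) rfl rfl
      have d2 := h.degenerate _ hA _ hB _ hC p V.2 0 j (j + 1) (by module) rfl rfl
      have d3 := h.antisymm_right hA hB hB'
      have q1 := par_eq N (p := p) (f := V.1) (e := ((j : ℝ) + 1) • V.2) rfl rfl rfl
      have q2 := par_eq N (p := p) (f := V.1) (e := (j : ℝ) • V.2) rfl rfl rfl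
      have q3 := par_eq N (p := p + (j : ℝ) • V.2) (f := V.1) (e := V.2)
        (b := p + V.1 + (j : ℝ) • V.2) (c := p + V.1 + ((j : ℝ) + 1) • V.2)
        (d := p + ((j : ℝ) + 1) • V.2) (by module) (by module) (by module)
      simp only [hF, Finset.sum_range_succ, hc, q1, q2, q3, delta]
      linarith
  have h0 := (key j).eq_zero (by norm_num) (p := p) (V := (f, e)) (fun p V hV => ?_)
    ⟨hp, hf, he, hfe⟩
  · simp only [hF] at h0
    linarith
  have hj0 : (0 : ℝ) ≤ j := Nat.cast_nonneg j
  obtain ⟨hm, hm'⟩ := hmem j p V hV ((j : ℝ) / 2) (by positivity) (by linarith)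
  have hmid : ∀ x : ℝ, 0 ≤ x → x ≤ j → p + (1 / 2 : ℝ) • V.1 + x • V.2 ∈ K := fun x hx hx' => by
    obtain ⟨h1, h2⟩ := hmem j p V hV x hx hx'
    exact h.convex.mem_of_line (p := p + x • V.2) (e := V.1) (x := 0) (y := 1) (z := 1 / 2)
      (by simpa) (by convert h2 using 1; module) (by norm_num) (by norm_num) (by module)
  obtain ⟨hp, hf, he, hfe⟩ := hV
  set f' := (1 / 2 : ℝ) • V.1 with hf'
  set e' := (1 / 2 : ℝ) • V.2 with he'
  have e1 : p + f' + f' = p + V.1 := by module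
  have e2 : p + (j : ℝ) • e' = p + ((j : ℝ) / 2) • V.2 := by module
  have e3 : p + ((j : ℝ) / 2) • V.2 + (j : ℝ) • e' = p + (j : ℝ) • V.2 := by module
  have e4 : p + f' + (j : ℝ) • e' = p + f' + ((j : ℝ) / 2) • V.2 := by module
  have e5 : p + V.1 + (j : ℝ) • e' = p + V.1 + ((j : ℝ) / 2) • V.2 := by module
  have e6 : p + ((j : ℝ) / 2) • V.2 + f' = p + f' + ((j : ℝ) / 2) • V.2 := by module
  have e7 : p + f' + ((j : ℝ) / 2) • V.2 + f' = p + V.1 + ((j : ℝ) / 2) • V.2 := by module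
  have e8 : p + f' + ((j : ℝ) / 2) • V.2 + (j : ℝ) • e' = p + f' + (j : ℝ) • V.2 := by module
  have e9 : p + V.1 + ((j : ℝ) / 2) • V.2 + (j : ℝ) • e' = p + V.1 + (j : ℝ) • V.2 := by module
  have k0 : p + f' ∈ K := by simpa using hmid 0 le_rfl hj0
  have k1 := hmid ((j : ℝ) / 2) (by positivity) (by linarith)
  have k2 := hmid j hj0 le_rfl
  refine ⟨[(p, 1 / 2), (p + f', 1 / 2), (p + ((j : ℝ) / 2) • V.2, 1 / 2),
    (p + f' + ((j : ℝ) / 2) • V.2, 1 / 2)], by simp, ?_, ?_⟩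
  · simp only [dom, List.forall_mem_cons, List.not_mem_nil, false_imp_iff, implies_true, and_true,
      Prod.smul_fst, Prod.smul_snd, ← hf', ← he', e1, e2, e3, e4, e5, e6, e7, e8, e9]
    refine ⟨⟨?_, hp, k0, hm, k1⟩, ⟨?_, k0, hf, k1, hm'⟩, ⟨?_, hm, k1, he, k2⟩,
      ⟨?_, k1, hm', k2, hfe⟩⟩ <;> norm_num [abs_of_pos]
  · simp only [List.map_cons, List.map_nil, List.sum_cons, List.sum_nil, hF,
      Prod.smul_fst, Prod.smul_snd, ← hf', ← he']
    have h1 := h.par_split hp hf he hfe (f' := f') (e' := (j : ℝ) • e') hf' (by module)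
    rw [e2, e4] at h1
    have h2 := sum_range_two_mul_eq j fun i =>
      par N (p + ((i : ℝ) / 2) • V.2) f' e' + par N (p + f' + ((i : ℝ) / 2) • V.2) f' e'
    have h3 : ∀ i ∈ Finset.range j, par N (p + (i : ℝ) • V.2) V.1 V.2 =
        (par N (p + (((2 * i : ℕ) : ℝ) / 2) • V.2) f' e' +
          par N (p + f' + (((2 * i : ℕ) : ℝ) / 2) • V.2) f' e') +
        (par N (p + (((2 * i + 1 : ℕ) : ℝ) / 2) • V.2) f' e' +
          par N (p + f' + (((2 * i + 1 : ℕ) : ℝ) / 2) • V.2) f' e') := by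
      intro i hi
      have hij : ((i : ℝ) + 1) ≤ j := by exact_mod_cast Finset.mem_range.1 hi
      have hi0 : (0 : ℝ) ≤ i := Nat.cast_nonneg i
      obtain ⟨m1, m2⟩ := hmem j p V ⟨hp, hf, he, hfe⟩ i hi0 (by linarith)
      obtain ⟨m3, m4⟩ := hmem j p V ⟨hp, hf, he, hfe⟩ ((i : ℝ) + 1) (by linarith) hij
      rw [h.par_split m1 (by convert m2 using 1; module) (by convert m3 using 1; module)
        (by convert m4 using 1; module) hf' he']
      have a1 : p + (((2 * i : ℕ) : ℝ) / 2) • V.2 = p + (i : ℝ) • V.2 := by push_cast; module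
      have a2 : p + f' + (((2 * i : ℕ) : ℝ) / 2) • V.2 = p + (i : ℝ) • V.2 + f' := by
        push_cast; module
      have a3 : p + (((2 * i + 1 : ℕ) : ℝ) / 2) • V.2 = p + (i : ℝ) • V.2 + e' := by
        push_cast; module
      have a4 : p + f' + (((2 * i + 1 : ℕ) : ℝ) / 2) • V.2 = p + (i : ℝ) • V.2 + f' + e' := by
        push_cast; module
      rw [a1, a2, a3, a4]
      ring
    rw [Finset.sum_congr rfl h3, ← h2, h1]
    have b1 : ∀ i : ℕ, p + ((i : ℝ) / 2) • V.2 = p + (i : ℝ) • e' := fun i => by module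
    have b2 : ∀ i : ℕ, p + f' + ((i : ℝ) / 2) • V.2 = p + f' + (i : ℝ) • e' := fun i => by module
    have b3 : ∀ i : ℕ, p + (((j + i : ℕ) : ℝ) / 2) • V.2 =
        p + ((j : ℝ) / 2) • V.2 + (i : ℝ) • e' := fun i => by push_cast; module
    have b4 : ∀ i : ℕ, p + f' + (((j + i : ℕ) : ℝ) / 2) • V.2 =
        p + f' + ((j : ℝ) / 2) • V.2 + (i : ℝ) • e' := fun i => by push_cast; module
    simp only [b3, b4, Finset.sum_add_distrib]
    simp only [b1 _, b2 _, he']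
    ring

end SewnTriangles

end Triangles

/-! ### Sewn 2-germs: real ratios, shearing, cutting, coplanar points -/

namespace SewnTriangles

variable {E : Type*} [NormedAddCommGroup E] [NormedSpace ℝ E] {K : Set E} {N : E → E → E → ℝ}

theorem par_add_nat (h : SewnTriangles K N) (i j : ℕ) {p f e : E} (hp : p ∈ K) (hf : p + f ∈ K)
    (he : p + ((i : ℝ) + j) • e ∈ K) (hfe : p + f + ((i : ℝ) + j) • e ∈ K) :
    par N p f (((i : ℝ) + j) • e) =
      par N p f ((i : ℝ) • e) + par N (p + (i : ℝ) • e) f ((j : ℝ) • e) := by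
  have hi : p + (i : ℝ) • e ∈ K := h.convex.mem_of_line (p := p) (e := e) (x := 0)
    (y := (i : ℝ) + j) (by simpa) he (by positivity) (by simp) rfl
  have hi' : p + f + (i : ℝ) • e ∈ K := h.convex.mem_of_line (p := p + f) (e := e) (x := 0)
    (y := (i : ℝ) + j) (by simpa) hfe (by positivity) (by simp) rfl
  have h1 := h.par_eq_sum (i + j) (p := p) (f := f) (e := e) hp hf (by simpa using he)
    (by simpa using hfe)
  have h2 := h.par_eq_sum i hp hf hi hi'
  have h3 := h.par_eq_sum j (p := p + (i : ℝ) • e) (f := f) (e := e) hi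
    (by convert hi' using 1; module) (by convert he using 1; module)
    (by convert hfe using 1; module)
  push_cast at h1
  rw [h1, h2, h3, Finset.sum_range_add]
  congr 1
  refine Finset.sum_congr rfl fun l _ => ?_
  push_cast
  congr 1
  module

theorem par_add_convex (h : SewnTriangles K N) {p f e : E} (hp : p ∈ K) (hf : p + f ∈ K)
    (he : p + e ∈ K) (hfe : p + f + e ∈ K) {t : ℝ} (ht : t ∈ Set.Icc (0 : ℝ) 1) :
    par N p f e = par N p f (t • e) + par N (p + t • e) f ((1 - t) • e) := by
  have m1 : ∀ s ∈ Set.Icc (0 : ℝ) 1, p + s • e ∈ K := fun s hs =>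
    h.convex.mem_of_line (p := p) (e := e) (x := 0) (y := 1) (by simpa) (by simpa) hs.1 hs.2 rfl
  have m2 : ∀ s ∈ Set.Icc (0 : ℝ) 1, p + f + s • e ∈ K := fun s hs =>
    h.convex.mem_of_line (p := p + f) (e := e) (x := 0) (y := 1) (by simpa) (by simpa) hs.1 hs.2 rfl
  have e1 : ∀ s : ℝ, p + s • e + f = p + f + s • e := fun s => by module
  have e2 : ∀ s : ℝ, p + f + s • e + (1 - s) • e = p + f + e := fun s => by module
  have e3 : ∀ s : ℝ, p + s • e + (1 - s) • e = p + e := fun s => by module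
  refine sub_eq_zero.1 (eq_zero_of_forall_rational (h := fun s => par N p f e -
    (par N p f (s • e) + par N (p + s • e) f ((1 - s) • e))) ?_ ?_ ht)
  · have hN : ∀ A B C : ℝ → E, Continuous A → Continuous B → Continuous C →
        (∀ s ∈ Set.Icc (0 : ℝ) 1, A s ∈ K ∧ B s ∈ K ∧ C s ∈ K) →
        ContinuousOn (fun s => N (A s) (B s) (C s)) (Set.Icc 0 1) := fun A B C hA hB hC H =>
      h.continuousOn.comp (hA.prodMk (hB.prodMk hC)).continuousOn H
    simp only [par, e1, e2, e3]
    refine continuousOn_const.sub (((hN _ _ _ ?_ ?_ ?_ ?_).add (hN _ _ _ ?_ ?_ ?_ ?_)).add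
      ((hN _ _ _ ?_ ?_ ?_ ?_).add (hN _ _ _ ?_ ?_ ?_ ?_)))
    any_goals fun_prop
    · exact fun s hs => ⟨hp, hf, m2 s hs⟩
    · exact fun s hs => ⟨hp, m2 s hs, m1 s hs⟩
    · exact fun s hs => ⟨m1 s hs, m2 s hs, hfe⟩
    · exact fun s hs => ⟨m1 s hs, hfe, he⟩
  · intro i j hij
    have hij' : (0 : ℝ) < (i : ℝ) + j := by exact_mod_cast hij
    have a1 : ((i : ℝ) + j) • (((i : ℝ) + j)⁻¹ • e) = e := by
      rw [smul_smul, mul_inv_cancel₀ hij'.ne', one_smul]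
    have a2 : (i : ℝ) • (((i : ℝ) + j)⁻¹ • e) = ((i : ℝ) / (i + j)) • e := by
      rw [div_eq_mul_inv, smul_smul]
    have a3 : (j : ℝ) • (((i : ℝ) + j)⁻¹ • e) = (1 - (i : ℝ) / (i + j)) • e := by
      rw [smul_smul]; congr 1; field_simp; ring
    have := h.par_add_nat i j (p := p) (f := f) (e := ((i : ℝ) + j)⁻¹ • e) hp hf (by rwa [a1])
      (by rwa [a1])
    rw [a1, a2, a3] at this
    linarith

theorem par_add (h : SewnTriangles K N) {p f e : E} {s t : ℝ} (hs : 0 ≤ s) (ht : 0 ≤ t)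
    (hp : p ∈ K) (hf : p + f ∈ K) (he : p + (s + t) • e ∈ K) (hfe : p + f + (s + t) • e ∈ K) :
    par N p f ((s + t) • e) = par N p f (s • e) + par N (p + s • e) f (t • e) := by
  rcases (add_nonneg hs ht).eq_or_lt with h0 | h0
  · have hs0 : s = 0 := by linarith
    have ht0 : t = 0 := by linarith
    subst hs0 ht0
    simp only [add_zero, zero_smul, h.par_zero hp hf]
  · have := h.par_add_convex hp hf he hfe (t := s / (s + t))
      ⟨by positivity, (div_le_one h0).2 (by linarith)⟩
    rw [this, smul_smul, smul_smul]
    congr <;> field_simp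
    ring

/-- In the dyadic decomposition, the corner at `a + F` and the medial triangle fit together to a
parallelogram; two corner triangles remain. -/
theorem triangle_split (h : SewnTriangles K N) {a F G : E} (ha : a ∈ K) (hF : a + F ∈ K)
    (hG : a + G ∈ K) {F' G' e : E} (hF' : F' = (1 / 2 : ℝ) • F) (hG' : G' = (1 / 2 : ℝ) • G)
    (he : e = (1 / 2 : ℝ) • (G - F)) :
    N a (a + F) (a + G) = N a (a + F') (a + G') + N (a + G') (a + G' + F') (a + G) +
      par N (a + F') F' e := by
  subst hF' hG'
  have m1 : a + (1 / 2 : ℝ) • F ∈ K := h.convex.mem_of_triangle (x := 1 / 2) (y := 0) ha hF hG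
    (by norm_num) (by norm_num) (by norm_num) (by module)
  have m2 : a + (1 / 2 : ℝ) • G ∈ K := h.convex.mem_of_triangle (x := 0) (y := 1 / 2) ha hF hG
    (by norm_num) (by norm_num) (by norm_num) (by module)
  have m3 : a + (1 / 2 : ℝ) • G + (1 / 2 : ℝ) • F ∈ K := h.convex.mem_of_triangle (x := 1 / 2)
    (y := 1 / 2) ha hF hG (by norm_num) (by norm_num) (by norm_num) (by module)
  have h1 := h.dyadic a ha _ hF _ hG (a + (1 / 2 : ℝ) • G + (1 / 2 : ℝ) • F)
    (a + (1 / 2 : ℝ) • G) (a + (1 / 2 : ℝ) • F) (by module) (by module) (by module)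
  have q1 := par_eq N (p := a + (1 / 2 : ℝ) • F) (f := (1 / 2 : ℝ) • F) (e := e) (b := a + F)
    (c := a + (1 / 2 : ℝ) • G + (1 / 2 : ℝ) • F) (d := a + (1 / 2 : ℝ) • G) (by module)
    (by rw [he]; module) (by rw [he]; module)
  rw [q1, h1]
  linarith [h.cyclic m1 m3 m2]

/-- Shearing a parallelogram exchanges two translated triangles. -/
theorem shear (h : SewnTriangles K N) {s t : ℝ} (hs : 0 ≤ s) (ht : 0 ≤ t) {b f e : E} (hb : b ∈ K)
    (hc : b + s • e ∈ K) (hB : b + f ∈ K) (hC : b + f + (s + t) • e ∈ K) :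
    par N b (f + t • e) (s • e) - par N b f (s • e) + N b (b + f) (b + f + t • e)
      - N (b + s • e) (b + f + s • e) (b + f + (s + t) • e) = 0 := by
  set F : E → E × E → ℝ := fun b V => par N b (V.1 + t • V.2) (s • V.2) - par N b V.1 (s • V.2)
    + N b (b + V.1) (b + V.1 + t • V.2)
    - N (b + s • V.2) (b + V.1 + s • V.2) (b + V.1 + (s + t) • V.2) with hF
  let dom : E → E × E → Prop := fun b V =>
    b ∈ K ∧ b + s • V.2 ∈ K ∧ b + V.1 ∈ K ∧ b + V.1 + (s + t) • V.2 ∈ K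
  have htop : ∀ b V, dom b V → ∀ x, 0 ≤ x → x ≤ s + t → b + V.1 + x • V.2 ∈ K :=
    fun b V hV x hx hx' => h.convex.mem_of_line (p := b + V.1) (e := V.2) (x := 0) (y := s + t)
      (by simpa using hV.2.2.1) hV.2.2.2 hx hx' rfl
  have key : Small 4 dom F := by
    have s1 := h.delta_small (dom := dom) (A := fun b _ => b) (B := fun b V => b + s • V.2)
      (C := fun b V => b + V.1 + s • V.2) (D := fun b V => b + V.1 + (s + t) • V.2)
      ⟨0, 0, fun p V => by module⟩ ⟨0, s, fun p V => by module⟩ ⟨1, s, fun p V => by module⟩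
      ⟨1, s + t, fun p V => by module⟩
      fun p V hV => ⟨hV.1, hV.2.1, htop p V hV s hs (by linarith), hV.2.2.2⟩
    have s2 := h.delta_small (dom := dom) (A := fun b _ => b) (B := fun b V => b + V.1)
      (C := fun b V => b + V.1 + t • V.2) (D := fun b V => b + V.1 + (s + t) • V.2)
      ⟨0, 0, fun p V => by module⟩ ⟨1, 0, fun p V => by module⟩ ⟨1, t, fun p V => by module⟩
      ⟨1, s + t, fun p V => by module⟩
      fun p V hV => ⟨hV.1, hV.2.2.1, htop p V hV t ht (by linarith), hV.2.2.2⟩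
    have s3 := h.delta_small (dom := dom) (A := fun b _ => b) (B := fun b V => b + V.1)
      (C := fun b V => b + V.1 + s • V.2) (D := fun b V => b + V.1 + (s + t) • V.2)
      ⟨0, 0, fun p V => by module⟩ ⟨1, 0, fun p V => by module⟩ ⟨1, s, fun p V => by module⟩
      ⟨1, s + t, fun p V => by module⟩
      fun p V hV => ⟨hV.1, hV.2.2.1, htop p V hV s hs (by linarith), hV.2.2.2⟩
    refine ((s1.neg.add s2.neg).add s3).mono (fun _ _ h => h) fun b V hV => ?_
    have mC := htop b V hV s hs (by linarith)
    have mB := htop b V hV t ht (by linarith)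
    obtain ⟨hb, hc, hB, hC⟩ := hV
    have d1 := h.degenerate _ hB _ mB _ hC (b + V.1) V.2 0 t (s + t) (by module) rfl rfl
    have d2 := h.degenerate _ hB _ mC _ hC (b + V.1) V.2 0 s (s + t) (by module) rfl rfl
    have a1 := h.antisymm_right hb hc hC
    have a2 := h.antisymm_right hb hc mC
    have q1 := par_eq N (p := b) (f := V.1 + t • V.2) (e := s • V.2) (b := b + V.1 + t • V.2)
      (c := b + V.1 + (s + t) • V.2) (d := b + s • V.2) (by module) (by module) rfl
    have q2 := par_eq N (p := b) (f := V.1) (e := s • V.2) rfl rfl rfl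
    simp only [hF, delta, q1, q2]
    linarith
  refine key.eq_zero (by norm_num) (p := b) (V := (f, e)) (fun b V hV => ?_) ⟨hb, hc, hB, hC⟩
  have hK := h.convex
  have top := htop b V hV
  obtain ⟨hb, hc, hB, hC⟩ := hV
  have bot : ∀ x, 0 ≤ x → x ≤ s → b + x • V.2 ∈ K := fun x hx hx' =>
    hK.mem_of_line (p := b) (e := V.2) (x := 0) (y := s) (by simpa) hc hx hx' rfl
  have mid : ∀ x y, 0 ≤ x → x ≤ s → 0 ≤ y → y ≤ s + t →
      b + (1 / 2 : ℝ) • V.1 + ((x + y) / 2) • V.2 ∈ K := fun x y hx hx' hy hy' =>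
    hK.mem_of_line (p := b + x • V.2) (e := V.1 + (y - x) • V.2) (x := 0) (y := 1) (z := 1 / 2)
      (by simpa using bot x hx hx') (by convert top y hy hy' using 1; module) (by norm_num)
      (by norm_num) (by module)
  set f' := (1 / 2 : ℝ) • V.1 with hf'
  set e' := (1 / 2 : ℝ) • V.2 with he'
  have m00 : b + f' ∈ K := by simpa using mid 0 0 le_rfl hs le_rfl (by linarith)
  have m0s : b + (s / 2) • V.2 ∈ K := bot _ (by linarith) (by linarith)
  have m1t : b + f' + (t / 2) • V.2 ∈ K := by
    convert mid 0 t le_rfl hs ht (by linarith) using 1; module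
  have m1s : b + f' + (s / 2) • V.2 ∈ K := by
    convert mid 0 s le_rfl hs hs (by linarith) using 1; module
  have m1st : b + f' + ((s + t) / 2) • V.2 ∈ K := by
    convert mid 0 (s + t) le_rfl hs (by linarith) le_rfl using 1; module
  have m1sst : b + f' + (s + t / 2) • V.2 ∈ K := by
    convert mid s (s + t) hs le_rfl (by linarith) le_rfl using 1; module
  have m2t : b + V.1 + t • V.2 ∈ K := top t ht (by linarith)
  have m2s : b + V.1 + s • V.2 ∈ K := top s hs (by linarith)
  have m2t' : b + V.1 + (t / 2) • V.2 ∈ K := top _ (by linarith) (by linarith)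
  have m2st : b + V.1 + (s / 2 + t) • V.2 ∈ K := top _ (by linarith) (by linarith)
  have m2sst : b + V.1 + (s + t / 2) • V.2 ∈ K := top _ (by linarith) (by linarith)
  have m2st' : b + V.1 + ((s + t) / 2) • V.2 ∈ K := top _ (by linarith) (by linarith)
  -- The four half-size trapezoids sit at the base points of the four quarters of the sheared
  -- parallelogram. The translated triangles telescope along each of the two rows.
  refine ⟨[(b, 1 / 2), (b + (s / 2) • V.2, 1 / 2), (b + f' + (t / 2) • V.2, 1 / 2),
    (b + f' + ((s + t) / 2) • V.2, 1 / 2)], by simp, ?_, ?_⟩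
  · simp only [dom, List.forall_mem_cons, List.not_mem_nil, false_imp_iff, implies_true, and_true,
      Prod.smul_fst, Prod.smul_snd, ← hf', ← he']
    refine ⟨⟨?_, hb, ?_, m00, ?_⟩, ⟨?_, m0s, ?_, ?_, ?_⟩, ⟨?_, m1t, ?_, ?_, ?_⟩,
      ⟨?_, m1st, ?_, ?_, ?_⟩⟩
    · norm_num [abs_of_pos]
    · convert m0s using 1; module
    · convert m1st using 1; module
    · norm_num [abs_of_pos]
    · convert hc using 1; module
    · convert m1s using 1; module
    · convert m1sst using 1; module
    · norm_num [abs_of_pos]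
    · convert m1st using 1; module
    · convert m2t' using 1; module
    · convert m2st using 1; module
    · norm_num [abs_of_pos]
    · convert m1sst using 1; module
    · convert m2st' using 1; module
    · convert hC using 1; module
  · simp only [List.map_cons, List.map_nil, List.sum_cons, List.sum_nil, hF,
      Prod.smul_fst, Prod.smul_snd, ← hf', ← he']
    have p1 := h.par_split (p := b) (f := V.1 + t • V.2) (e := s • V.2) (f' := f' + t • e')
      (e' := s • e') hb (by convert m2t using 1; module) hc (by convert hC using 1; module)
      (by module) (by module)
    have p2 := h.par_split (p := b) (f := V.1) (e := s • V.2) (f' := f') (e' := s • e')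
      hb hB hc m2s hf' (by module)
    have t1 := h.triangle_split (a := b) (F := V.1) (G := V.1 + t • V.2) (F' := f')
      (G' := f' + t • e') (e := t • e') hb hB (by convert m2t using 1; module) hf' (by module)
      (by module)
    have t2 := h.triangle_split (a := b + s • V.2) (F := V.1) (G := V.1 + t • V.2) (F' := f')
      (G' := f' + t • e') (e := t • e') hc (by convert m2s using 1; module)
      (by convert hC using 1; module) hf' (by module) (by module)
    -- The upper row of width `2s + t` (in units of `e'`) is cut in both orders, `t` then `2s` and
    -- `2s` then `t`. This accounts for the parallelograms left over from splitting the two large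
    -- triangles.
    have r1 := h.par_add (p := b + f') (f := f') (e := e') (s := t) (t := s + s) ht (by linarith)
      m00 (by convert hB using 1; module) (by convert m1sst using 1; module)
      (by convert m2sst using 1; module)
    have r2 := h.par_add (p := b + f' + t • e') (f := f') (e := e') (s := s) (t := s) hs hs
      (by convert m1t using 1; module) (by convert m2t' using 1; module)
      (by convert m1sst using 1; module) (by convert m2sst using 1; module)
    have r3 := h.par_add (p := b + f') (f := f') (e := e') (s := s + s) (t := t) (by linarith) ht
      m00 (by convert hB using 1; module) (by convert m1sst using 1; module)
      (by convert m2sst using 1; module)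
    have r4 := h.par_add (p := b + f') (f := f') (e := e') (s := s) (t := s) hs hs
      m00 (by convert hB using 1; module) (by convert mid s s hs le_rfl hs (by linarith) using 1; module)
      (by convert m2s using 1; module)
    have c0 : t + (s + s) = s + s + t := by ring
    have c1 : b + (s / 2) • V.2 = b + s • e' := by module
    have c2 : b + f' + (t / 2) • V.2 = b + f' + t • e' := by module
    have c3 : b + f' + ((s + t) / 2) • V.2 = b + f' + t • e' + s • e' := by module
    have c4 : b + (f' + t • e') = b + f' + t • e' := by module
    have c5 : b + s • V.2 + f' = b + f' + (s + s) • e' := by module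
    rw [c0] at r1
    have x1 : b + s • e' + f' = b + f' + s • e' := by module
    rw [p1, p2, c1, c2, c3, c4]
    rw [c4] at t1
    have u1 : b + (V.1 + t • V.2) = b + V.1 + t • V.2 := by module
    have u2 : b + s • V.2 + V.1 = b + V.1 + s • V.2 := by module
    have u3 : b + s • V.2 + (V.1 + t • V.2) = b + V.1 + (s + t) • V.2 := by module
    have u4 : b + f' + t • e' + f' + t • e' = b + V.1 + t • V.2 := by module
    have u5 : b + f' + t • e' + s • e' + s • e' = b + s • V.2 + (f' + t • e') := by module
    have u6 : b + f' + t • e' + s • e' + f' + s • e' = b + s • V.2 + (f' + t • e') + f' := by module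
    have u7 : b + f' + t • e' + s • e' + f' + (s + t) • e' = b + V.1 + (s + t) • V.2 := by module
    have u8 : b + s • e' + s • e' = b + s • V.2 := by module
    have u9 : b + s • e' + f' + s • e' = b + s • V.2 + f' := by module
    have u10 : b + s • e' + f' + (s + t) • e' = b + s • V.2 + (f' + t • e') := by module
    have u11 : b + s • e' + f' + t • e' = b + f' + t • e' + s • e' := by module
    have u12 : b + f' + (s + t) • e' = b + f' + t • e' + s • e' := by module
    have u13 : b + f' + t • e' + f' + (s + t) • e' =
      b + f' + t • e' + s • e' + f' + t • e' := by module
    have u14 : b + f' + t • e' + f' + s • e' = b + f' + t • e' + s • e' + f' := by module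
    rw [u1] at t1
    rw [u2, u3] at t2
    rw [u4, u5, u6, u7, u8, u9, u10, u11, u12, u13, u14]
    rw [t1, t2, x1, c5]
    linarith

/-- A triangle is cut additively by a segment through its first vertex. -/
theorem cut (h : SewnTriangles K N) {s t : ℝ} (hs : 0 ≤ s) (ht : 0 ≤ t) {a f e : E} (ha : a ∈ K)
    (hf : a + f ∈ K) (he : a + f + (s + t) • e ∈ K) :
    N a (a + f) (a + f + (s + t) • e) = N a (a + f) (a + f + s • e) +
      N a (a + f + s • e) (a + f + (s + t) • e) := by
  set F : E → E × E → ℝ := fun a V => N a (a + V.1) (a + V.1 + s • V.2) +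
    N a (a + V.1 + s • V.2) (a + V.1 + (s + t) • V.2) -
    N a (a + V.1) (a + V.1 + (s + t) • V.2) with hF
  let dom : E → E × E → Prop := fun a V => a ∈ K ∧ a + V.1 ∈ K ∧ a + V.1 + (s + t) • V.2 ∈ K
  have hbase : ∀ a V, dom a V → ∀ x, 0 ≤ x → x ≤ s + t → a + V.1 + x • V.2 ∈ K :=
    fun a V hV x hx hx' => h.convex.mem_of_line (p := a + V.1) (e := V.2) (x := 0) (y := s + t)
      (by simpa using hV.2.1) hV.2.2 hx hx' rfl
  have key : Small 4 dom F := by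
    have s1 := h.delta_small (dom := dom) (A := fun a _ => a) (B := fun a V => a + V.1)
      (C := fun a V => a + V.1 + s • V.2) (D := fun a V => a + V.1 + (s + t) • V.2)
      ⟨0, 0, fun p V => by module⟩ ⟨1, 0, fun p V => by module⟩ ⟨1, s, fun p V => by module⟩
      ⟨1, s + t, fun p V => by module⟩
      fun a V hV => ⟨hV.1, hV.2.1, hbase a V hV s hs (by linarith), hV.2.2⟩
    refine s1.neg.mono (fun _ _ h => h) fun a V hV => ?_
    have d := h.degenerate _ hV.2.1 _ (hbase a V hV s hs (by linarith)) _ hV.2.2 (a + V.1) V.2 0 s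
      (s + t) (by module) rfl rfl
    simp only [hF, delta, d]
    ring
  have h0 := key.eq_zero (by norm_num) (p := a) (V := (f, e)) (fun a V hV => ?_) ⟨ha, hf, he⟩
  · simp only [hF] at h0
    linarith
  have base := hbase a V hV
  obtain ⟨ha, hf, he⟩ := hV
  have mid : ∀ x, 0 ≤ x → x ≤ s + t → a + (1 / 2 : ℝ) • (V.1 + x • V.2) ∈ K := fun x hx hx' =>
    h.convex.mem_of_line (p := a) (e := V.1 + x • V.2) (x := 0) (y := 1) (z := 1 / 2)
      (by simpa) (by convert base x hx hx' using 1; module) (by norm_num) (by norm_num) rfl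
  have mid2 : ∀ x y, 0 ≤ x → x ≤ s + t → 0 ≤ y → y ≤ s + t →
      a + V.1 + ((x + y) / 2) • V.2 ∈ K := fun x y hx hx' hy hy' =>
    base _ (by linarith) (by linarith)
  set f' := (1 / 2 : ℝ) • V.1 with hf'
  set e' := (1 / 2 : ℝ) • V.2 with he'
  have m0 : a + f' ∈ K := by convert mid 0 le_rfl (by linarith) using 1; module
  have ms : a + f' + s • e' ∈ K := by convert mid s hs (by linarith) using 1; module
  have mst : a + f' + (s + t) • e' ∈ K := by convert mid (s + t) (by linarith) le_rfl using 1; module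
  -- Only two half-size copies appear: the one at the apex and the one at the third vertex. The rest
  -- of the dyadic pieces cancels.
  refine ⟨[(a, 1 / 2), (a + f' + (s + t) • e', 1 / 2)], by simp, ?_, ?_⟩
  · simp only [dom, List.forall_mem_cons, List.not_mem_nil, false_imp_iff, implies_true, and_true,
      Prod.smul_fst, Prod.smul_snd, ← hf', ← he']
    refine ⟨⟨?_, ha, m0, mst⟩, ⟨?_, mst, ?_, ?_⟩⟩
    · norm_num [abs_of_pos]
    · norm_num [abs_of_pos]
    · convert mid2 0 (s + t) le_rfl (by linarith) (by linarith) le_rfl using 1; module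
    · convert he using 1; module
  · simp only [List.map_cons, List.map_nil, List.sum_cons, List.sum_nil, hF,
      Prod.smul_fst, Prod.smul_snd, ← hf', ← he']
    have hs1 := base s hs (by linarith)
    have g1 : a + (V.1 + s • V.2) = a + V.1 + s • V.2 := by module
    have g2 : a + (V.1 + (s + t) • V.2) = a + V.1 + (s + t) • V.2 := by module
    have g3 : a + (f' + s • e') = a + f' + s • e' := by module
    have g4 : a + (f' + (s + t) • e') = a + f' + (s + t) • e' := by module
    have t1 := h.triangle_split (a := a) (F := V.1) (G := V.1 + s • V.2) (F' := f')
      (G' := f' + s • e') (e := s • e') ha hf (by rwa [g1]) hf' (by module) (by module)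
    have t2 := h.triangle_split (a := a) (F := V.1 + s • V.2) (G := V.1 + (s + t) • V.2)
      (F' := f' + s • e') (G' := f' + (s + t) • e') (e := t • e') ha (by rwa [g1]) (by rwa [g2])
      (by module) (by module) (by module)
    have t3 := h.triangle_split (a := a) (F := V.1) (G := V.1 + (s + t) • V.2) (F' := f')
      (G' := f' + (s + t) • e') (e := (s + t) • e') ha hf (by rwa [g2]) hf' (by module) (by module)
    have r := h.par_add (p := a + f') (f := f') (e := e') hs ht m0 (by convert hf using 1; module)
      mst (by convert mid2 0 (s + t) le_rfl (by linarith) (by linarith) le_rfl using 1; module)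
    -- Splitting the first part leaves a triangle based at `a + f' + s e'`, whereas the second copy
    -- is based at `a + f' + (s + t) e'`. Shearing translates this triangle and straightens the
    -- parallelogram of the second part.
    have sh := h.shear (s := t) (t := s) ht hs (b := a + f' + s • e') (f := f') (e := e') ms
      (by convert mst using 1; module)
      (by convert mid2 0 s le_rfl (by linarith) hs (by linarith) using 1; module)
      (by convert mid2 s (s + t) hs (by linarith) (by linarith) le_rfl using 1; module)
    rw [g1, g3] at t1
    rw [g1, g2, g3, g4] at t2
    rw [g2, g4] at t3
    have v1 : a + f' + s • e' + t • e' = a + f' + (s + t) • e' := by module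
    have v2 : a + f' + s • e' + f' + s • e' = a + V.1 + s • V.2 := by module
    have v3 : a + f' + s • e' + f' + t • e' = a + f' + (s + t) • e' + f' := by module
    have v4 : a + f' + s • e' + f' + (t + s) • e' = a + f' + (s + t) • e' + f' + s • e' := by module
    have v5 : a + f' + (s + t) • e' + (f' + s • e') = a + f' + (s + t) • e' + f' + s • e' := by
      module
    have v6 : a + f' + (s + t) • e' + f' + (s + t) • e' = a + V.1 + (s + t) • V.2 := by module
    rw [v1, v2, v3, v4] at sh
    rw [v5] at t2
    rw [v6]
    linarith

theorem cut_of_mem_segment (h : SewnTriangles K N) {a b c x : E} (ha : a ∈ K) (hb : b ∈ K)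
    (hc : c ∈ K) (hx : x ∈ segment ℝ b c) : N a b c = N a b x + N a x c := by
  rw [segment_eq_image_lineMap] at hx
  obtain ⟨t, ht, rfl⟩ := hx
  have e1 : a + (b - a) = b := by module
  have e2 : a + (b - a) + (t + (1 - t)) • (c - b) = c := by module
  have e3 : a + (b - a) + t • (c - b) = AffineMap.lineMap b c t := by
    rw [AffineMap.lineMap_apply_module']; module
  have := h.cut (s := t) (t := 1 - t) ht.1 (by linarith [ht.2]) (a := a) (f := b - a) (e := c - b)
    ha (by rwa [e1]) (by rwa [e2])
  rwa [e2, e3, e1] at this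

theorem delta_swap₀ (h : SewnTriangles K N) {a b c d : E} (ha : a ∈ K) (hb : b ∈ K) (hc : c ∈ K)
    (hd : d ∈ K) : delta N b a c d = -delta N a b c d := by
  simp only [delta, h.antisymm_left ha hb hd, h.antisymm_left ha hb hc]
  ring

theorem delta_swap₁ (h : SewnTriangles K N) {a b c d : E} (ha : a ∈ K) (hb : b ∈ K) (hc : c ∈ K)
    (hd : d ∈ K) : delta N a c b d = -delta N a b c d := by
  simp only [delta, h.antisymm_left hb hc hd, h.antisymm_right ha hb hc]
  ring

theorem delta_swap₂ (h : SewnTriangles K N) {a b c d : E} (ha : a ∈ K) (hb : b ∈ K) (hc : c ∈ K)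
    (hd : d ∈ K) : delta N a b d c = -delta N a b c d := by
  simp only [delta, h.antisymm_right hb hc hd, h.antisymm_right ha hc hd]
  ring

/-- The line from `a` through `d` meets the opposite side in `x`. Cutting every triangle along `a,
d, x` makes both sides sums of the same pieces. -/
theorem delta_eq_zero_of_mem_triangle (h : SewnTriangles K N) {a b c d : E} (ha : a ∈ K)
    (hb : b ∈ K) (hc : c ∈ K) (hd : d ∈ convexHull ℝ {a, b, c}) : delta N a b c d = 0 := by
  rw [convexHull_insert (by simp), convexHull_pair, mem_convexJoin] at hd
  obtain ⟨_, rfl, x, hx, hd⟩ := hd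
  have hxK : x ∈ K := h.convex.segment_subset hb hc hx
  have hdK : d ∈ K := h.convex.segment_subset ha hxK hd
  have h1 := h.cut_of_mem_segment hdK hb hc hx
  have h2 := h.cut_of_mem_segment ha hb hc hx
  have h3 := h.cut_of_mem_segment hb ha hxK hd
  have h4 := h.cut_of_mem_segment hc ha hxK hd
  have c1 := h.cyclic hdK hb hc
  have c5 := h.cyclic hc ha hdK
  have c6 := h.cyclic hc ha hxK
  have c8 := h.cyclic hc hdK hxK
  have c9 := h.cyclic hdK hb hxK
  have a1 := h.antisymm_left ha hb hxK
  have a2 := h.antisymm_left ha hb hdK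
  have a3 := h.antisymm_right hb hdK hxK
  have a5 := h.antisymm_right ha hc hdK
  simp only [delta]
  linarith

/-- The two triangulations of a quadrilateral by its diagonals have a common refinement: the four
triangles at the crossing point. -/
theorem delta_eq_zero_of_segments_meet (h : SewnTriangles K N) {a b c d x : E} (ha : a ∈ K)
    (hb : b ∈ K) (hc : c ∈ K) (hd : d ∈ K) (hx : x ∈ segment ℝ a b) (hx' : x ∈ segment ℝ c d) :
    delta N a b c d = 0 := by
  have hxK : x ∈ K := h.convex.segment_subset ha hb hx
  have h1 := h.cut_of_mem_segment hc ha hb hx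
  have h2 := h.cut_of_mem_segment hd ha hb hx
  have h3 := h.cut_of_mem_segment ha hc hd hx'
  have h4 := h.cut_of_mem_segment hb hc hd hx'
  have c1 := h.cyclic hc ha hb
  have c2 := h.cyclic hd ha hb
  have c3 := h.cyclic hc ha hxK
  have c5 := h.cyclic hd ha hxK
  have c6 := h.cyclic hd hxK hb
  have c7 := h.cyclic hb hc hxK
  have a1 := h.antisymm_right ha hc hxK
  have a6 := h.antisymm_left hxK hb hd
  simp only [delta]
  linarith

/-- The coboundary of a sewn `2`-germ vanishes at coplanar points. -/
theorem closed (h : SewnTriangles K N) {q : Fin 4 → E} (hq : ∀ i, q i ∈ K)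
    (hdep : ¬AffineIndependent ℝ q) : delta N (q 0) (q 1) (q 2) (q 3) = 0 := by
  -- A Radon partition may be taken with `0 ∈ I`, by passing to the complement. Alternation of the
  -- coboundary reduces the remaining cases to the two configurations above; `I = univ` is
  -- impossible since the hull of the empty set is empty.
  have key : ∀ (I : Set (Fin 4)) (x : E), 0 ∈ I → x ∈ convexHull ℝ (q '' I) →
      x ∈ convexHull ℝ (q '' Iᶜ) → delta N (q 0) (q 1) (q 2) (q 3) = 0 := by
    intro I x h0 hx hx'
    by_cases h1 : 1 ∈ I <;> by_cases h2 : 2 ∈ I <;> by_cases h3 : 3 ∈ I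
    · have hI : I = Set.univ := by ext i; fin_cases i <;> simp [h0, h1, h2, h3]
      simp [hI] at hx'
    · have hI : I = {0, 1, 2} := by ext i; fin_cases i <;> simp [h0, h1, h2, h3]
      have hI' : Iᶜ = {3} := by ext i; fin_cases i <;> simp [h0, h1, h2, h3]
      rw [hI', Set.image_singleton, convexHull_singleton, Set.mem_singleton_iff] at hx'
      rw [hI, Set.image_insert_eq, Set.image_pair, hx'] at hx
      exact h.delta_eq_zero_of_mem_triangle (hq 0) (hq 1) (hq 2) hx
    · have hI : I = {0, 1, 3} := by ext i; fin_cases i <;> simp [h0, h1, h2, h3]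
      have hI' : Iᶜ = {2} := by ext i; fin_cases i <;> simp [h0, h1, h2, h3]
      rw [hI', Set.image_singleton, convexHull_singleton, Set.mem_singleton_iff] at hx'
      rw [hI, Set.image_insert_eq, Set.image_pair, hx'] at hx
      have := h.delta_eq_zero_of_mem_triangle (hq 0) (hq 1) (hq 3) hx
      linarith [h.delta_swap₂ (hq 0) (hq 1) (hq 2) (hq 3)]
    · have hI : I = {0, 1} := by ext i; fin_cases i <;> simp [h0, h1, h2, h3]
      have hI' : Iᶜ = {2, 3} := by ext i; fin_cases i <;> simp [h0, h1, h2, h3]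
      rw [hI', Set.image_pair, convexHull_pair] at hx'
      rw [hI, Set.image_pair, convexHull_pair] at hx
      exact h.delta_eq_zero_of_segments_meet (hq 0) (hq 1) (hq 2) (hq 3) hx hx'
    · have hI : I = {0, 2, 3} := by ext i; fin_cases i <;> simp [h0, h1, h2, h3]
      have hI' : Iᶜ = {1} := by ext i; fin_cases i <;> simp [h0, h1, h2, h3]
      rw [hI', Set.image_singleton, convexHull_singleton, Set.mem_singleton_iff] at hx'
      rw [hI, Set.image_insert_eq, Set.image_pair, hx'] at hx
      have := h.delta_eq_zero_of_mem_triangle (hq 0) (hq 2) (hq 3) hx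
      linarith [h.delta_swap₁ (hq 0) (hq 1) (hq 2) (hq 3),
        h.delta_swap₂ (hq 0) (hq 2) (hq 1) (hq 3)]
    · have hI : I = {0, 2} := by ext i; fin_cases i <;> simp [h0, h1, h2, h3]
      have hI' : Iᶜ = {1, 3} := by ext i; fin_cases i <;> simp [h0, h1, h2, h3]
      rw [hI', Set.image_pair, convexHull_pair] at hx'
      rw [hI, Set.image_pair, convexHull_pair] at hx
      have := h.delta_eq_zero_of_segments_meet (hq 0) (hq 2) (hq 1) (hq 3) hx hx'
      linarith [h.delta_swap₁ (hq 0) (hq 1) (hq 2) (hq 3)]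
    · have hI : I = {0, 3} := by ext i; fin_cases i <;> simp [h0, h1, h2, h3]
      have hI' : Iᶜ = {1, 2} := by ext i; fin_cases i <;> simp [h0, h1, h2, h3]
      rw [hI', Set.image_pair, convexHull_pair] at hx'
      rw [hI, Set.image_pair, convexHull_pair] at hx
      have := h.delta_eq_zero_of_segments_meet (hq 0) (hq 3) (hq 1) (hq 2) hx hx'
      linarith [h.delta_swap₂ (hq 0) (hq 1) (hq 2) (hq 3),
        h.delta_swap₁ (hq 0) (hq 1) (hq 3) (hq 2)]
    · have hI : I = {0} := by ext i; fin_cases i <;> simp [h0, h1, h2, h3]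
      have hI' : Iᶜ = {1, 2, 3} := by ext i; fin_cases i <;> simp [h0, h1, h2, h3]
      rw [hI, Set.image_singleton, convexHull_singleton, Set.mem_singleton_iff] at hx
      rw [hI', Set.image_insert_eq, Set.image_pair, hx] at hx'
      have := h.delta_eq_zero_of_mem_triangle (hq 1) (hq 2) (hq 3) hx'
      linarith [h.delta_swap₀ (hq 0) (hq 1) (hq 2) (hq 3),
        h.delta_swap₁ (hq 1) (hq 0) (hq 2) (hq 3),
        h.delta_swap₂ (hq 1) (hq 2) (hq 0) (hq 3)]
  obtain ⟨I, x, hx, hx'⟩ := Convex.radon_partition hdep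
  by_cases h0 : (0 : Fin 4) ∈ I
  · exact key I x h0 hx hx'
  · exact key Iᶜ x h0 hx' (by rwa [compl_compl])

end SewnTriangles

/-! ### Uniform gauges, convex combinations of vertices, summed gauges -/

section Gauges

variable {d : ℕ} {D : Set (Space d)} {k m : ℕ}

/-- `S'` is a translate of `s S`. -/
def IsCopy (s : ℝ) (S S' : Simplices D k) : Prop :=
  ∃ q, ∀ i, S'.1 i = q + s • S.1 i

theorem scale_isCopy (S : Simplices D k) (n : ℕ) : IsCopy ((1 / 2) ^ n) S (S.scale n) := by
  refine ⟨(1 - (1 / 2 : ℝ) ^ n) • S.1 0, fun i => ?_⟩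
  simp only [Simplices.scale, Simplices.inside, AffineMap.lineMap_apply_module', one_div]
  module

theorem IsCopy.trans {s t : ℝ} {S S' S'' : Simplices D k} (h : IsCopy s S S')
    (h' : IsCopy t S' S'') : IsCopy (t * s) S S'' := by
  obtain ⟨q, hq⟩ := h
  obtain ⟨q', hq'⟩ := h'
  refine ⟨q' + t • q, fun i => ?_⟩
  rw [hq', hq]
  module

theorem IsCopy.areIsometric {s t : ℝ} {S S' S'' : Simplices D k} (h : IsCopy s S S')
    (h' : IsCopy t S S'') (hst : |s| = |t|) : AreIsometric S' S'' := by
  obtain ⟨q, hq⟩ := h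
  obtain ⟨q', hq'⟩ := h'
  rcases abs_eq_abs.1 hst with rfl | rfl
  · refine ⟨fun x => x + (q' - q), isometry_add_right _, fun i => ?_⟩
    rw [hq, hq']
    module
  -- Opposite scale factors are exchanged by a point reflection, so a uniform gauge does not see the
  -- sign.
  · refine ⟨fun x => (q' + q) - x, (IsometryEquiv.subLeft _).isometry, fun i => ?_⟩
    rw [hq, hq']
    module

/-- An isometry into a strictly convex space is affine even without surjectivity. It follows that
simplices built by the same convex combinations from isometric simplices are isometric. -/
theorem _root_.Isometry.map_sum_smul {E F ι : Type*} [NormedAddCommGroup E] [NormedSpace ℝ E]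
    [NormedAddCommGroup F] [NormedSpace ℝ F] [StrictConvexSpace ℝ F] [Fintype ι] {f : E → F}
    (hf : Isometry f) (w : ι → ℝ) (hw : ∑ i, w i = 1) (p : ι → E) :
    f (∑ i, w i • p i) = ∑ i, w i • f (p i) := by
  let φ : E →ᵃ[ℝ] F := hf.affineIsometryOfStrictConvexSpace.toAffineMap
  have e : ∀ x, f x = φ.linear x + f 0 := fun x => congrFun φ.decomp x
  rw [e]
  simp only [e (p _), smul_add, Finset.sum_add_distrib, ← Finset.sum_smul, hw, one_smul, map_sum,
    map_smul]

theorem continuous_vertex (i : Fin (k + 1)) : Continuous fun S : Simplices D k => S.1 i :=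
  (continuous_apply i).comp continuous_subtype_val

theorem continuous_midpoint (i j : Fin (k + 1)) :
    Continuous fun S : Simplices D k => midpoint ℝ (S.1 i) (S.1 j) := by
  simp only [midpoint_eq_smul_add, invOf_eq_inv]
  exact ((continuous_vertex i).add (continuous_vertex j)).const_smul (2⁻¹ : ℝ)

/-- The simplex whose vertices are given convex combinations of those of `S`. -/
def Simplices.comb (S : Simplices D k) (w : Fin (m + 1) → stdSimplex ℝ (Fin (k + 1))) :
    Simplices D m :=
  S.inside (fun i => ∑ j, (w i).1 j • S.1 j) fun i =>
    (convex_convexHull ℝ _).sum_mem (fun j _ => (w i).2.1 j) (w i).2.2 fun j _ => S.vertex_mem j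

theorem continuous_comb (w : Fin (m + 1) → stdSimplex ℝ (Fin (k + 1))) :
    Continuous fun S : Simplices D k => S.comb w := by
  refine Continuous.subtype_mk (continuous_pi fun i => continuous_finsetSum _ fun j _ => ?_) _
  exact (continuous_vertex j).const_smul ((w i).1 j)

theorem AreIsometric.comb {S S' : Simplices D k} (h : AreIsometric S S')
    (w : Fin (m + 1) → stdSimplex ℝ (Fin (k + 1))) : AreIsometric (S.comb w) (S'.comb w) := by
  obtain ⟨f, hf, e⟩ := h
  refine ⟨f, hf, fun i => ?_⟩
  simp only [Simplices.comb, Simplices.inside, ← e]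
  exact hf.map_sum_smul _ (w i).2.2 _

theorem IsCopy.comb {s : ℝ} {S S' : Simplices D k} (h : IsCopy s S S')
    (w : Fin (m + 1) → stdSimplex ℝ (Fin (k + 1))) : IsCopy s (S.comb w) (S'.comb w) := by
  obtain ⟨q, hq⟩ := h
  refine ⟨q, fun i => ?_⟩
  simp only [Simplices.comb, Simplices.inside, hq, smul_add, Finset.sum_add_distrib,
    ← Finset.sum_smul, (w i).2.2, one_smul, Finset.smul_sum, smul_comm s]

theorem AreIsometric.scale {S S' : Simplices D k} (h : AreIsometric S S') (n : ℕ) :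
    AreIsometric (S.scale n) (S'.scale n) := by
  obtain ⟨f, hf, e⟩ := h
  refine ⟨f, hf, fun i => ?_⟩
  simp only [Simplices.scale, Simplices.inside, ← e]
  exact hf.affineIsometryOfStrictConvexSpace.toAffineMap.apply_lineMap _ _ _

theorem continuous_scale (n : ℕ) : Continuous fun S : Simplices D k => S.scale n := by
  refine Continuous.subtype_mk (continuous_pi fun i => ?_) _
  simp only [AffineMap.lineMap_apply_module']
  exact (((continuous_vertex i).sub (continuous_vertex 0)).const_smul ((2 : ℝ)⁻¹ ^ n)).add
    (continuous_vertex 0)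

theorem two_rpow_mul (n k : ℕ) : (2 : ℝ) ^ ((n : ℝ) * (k : ℝ)) = ((2 : ℝ) ^ k) ^ n := by
  rw [← pow_mul, mul_comm k n, ← Real.rpow_natCast]
  push_cast
  rfl

theorem IsUniform.eq_scale_of_isCopy {u : Germ D k} (hu : IsUniform u) {s : ℝ} {n : ℕ}
    {S S' : Simplices D k} (h : IsCopy s S S') (hs : |s| = (1 / 2) ^ n) : u S' = u (S.scale n) :=
  hu _ _ (h.areIsometric (scale_isCopy S n) (by rw [hs, abs_of_pos (by positivity)]))

theorem IsUniform.scale_scale {u : Germ D k} (hu : IsUniform u) (S : Simplices D k) (n m : ℕ) :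
    u ((S.scale n).scale m) = u (S.scale (n + m)) :=
  hu.eq_scale_of_isCopy ((scale_isCopy S n).trans (scale_isCopy _ m)) (by
    rw [abs_of_pos (by positivity), ← pow_add, add_comm])

theorem IsUniform.comb_scale {u : Germ D m} (hu : IsUniform u) (S : Simplices D k)
    (w : Fin (m + 1) → stdSimplex ℝ (Fin (k + 1))) (n : ℕ) :
    u ((S.scale n).comb w) = u ((S.comb w).scale n) :=
  hu.eq_scale_of_isCopy ((scale_isCopy S n).comb w) (abs_of_pos (by positivity))

theorem IsUniform.comb {u : Germ D m} (hu : IsUniform u)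
    (w : Fin (m + 1) → stdSimplex ℝ (Fin (k + 1))) :
    IsUniform fun S : Simplices D k => u (S.comb w) :=
  fun _ _ h => hu _ _ (h.comb w)

theorem IsDini.comb {r : ℝ} {u : Germ D m} (hu : IsDini r u)
    (w : Fin (m + 1) → stdSimplex ℝ (Fin (k + 1))) :
    IsDini r fun S : Simplices D k => u (S.comb w) :=
  ⟨fun _ => hu.1 _, hu.2.1.comb w, fun S => by
    simpa only [hu.2.1.comb_scale] using hu.2.2 (S.comb w)⟩

theorem IsDini.add {r : ℝ} {u u' : Germ D m} (hu : IsDini r u) (hu' : IsDini r u') :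
    IsDini r fun S => u S + u' S :=
  ⟨fun S => add_nonneg (hu.1 S) (hu'.1 S), fun S S' h => by
    simp only [hu.2.1 S S' h, hu'.2.1 S S' h], fun S => by
    simpa only [mul_add, add_zero] using (hu.2.2 S).add (hu'.2.2 S)⟩

theorem IsDini.const_mul {r c : ℝ} (hc : 0 ≤ c) {u : Germ D m} (hu : IsDini r u) :
    IsDini r fun S => c * u S :=
  ⟨fun S => mul_nonneg hc (hu.1 S), fun S S' h => by simp only [hu.2.1 S S' h], fun S => by
    simpa only [mul_left_comm, mul_zero] using (hu.2.2 S).const_mul c⟩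

theorem IsDini.sum {r : ℝ} {ι : Type*} (s : Finset ι) {u : ι → Germ D m}
    (hu : ∀ i ∈ s, IsDini r (u i)) : IsDini r fun S => ∑ i ∈ s, u i S :=
  ⟨fun S => Finset.sum_nonneg fun i hi => (hu i hi).1 S,
    fun S S' h => Finset.sum_congr rfl fun i hi => (hu i hi).2.1 S S' h, fun S => by
    simpa only [Finset.mul_sum, Finset.sum_const_zero] using
      tendsto_finsetSum s fun i hi => (hu i hi).2.2 S⟩

/-- The sum of the values of a gauge on finitely many simplices inside a given one. -/
def combGauge {N : ℕ} (u : Germ D m) (w : Fin N → Fin (m + 1) → stdSimplex ℝ (Fin (k + 1))) :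
    Germ D k :=
  fun S => ∑ i, u (S.comb (w i))

theorem IsStrongDini.combGauge {r : ℝ} {N : ℕ} {u : Germ D m} (hu : IsStrongDini r u)
    (w : Fin N → Fin (m + 1) → stdSimplex ℝ (Fin (k + 1))) : IsStrongDini r (combGauge u w) := by
  refine ⟨IsDini.sum _ fun i _ => hu.1.comb (w i), fun S => ?_⟩
  simp only [RoughForm.combGauge, hu.1.2.1.comb_scale, Finset.mul_sum]
  exact summable_sum fun i _ => hu.2 (S.comb (w i))

theorem summedGauge_combGauge {r : ℝ} {N : ℕ} {u : Germ D m} (hu : IsStrongDini r u)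
    (w : Fin N → Fin (m + 1) → stdSimplex ℝ (Fin (k + 1))) :
    summedGauge r (combGauge u w) = combGauge (summedGauge r u) w := by
  funext S
  simp only [summedGauge, combGauge, hu.1.2.1.comb_scale, Finset.mul_sum]
  exact Summable.tsum_finsetSum fun i _ => hu.2 (S.comb (w i))

theorem continuous_combGauge {N : ℕ} {u : Germ D m} (hu : Continuous u)
    (w : Fin N → Fin (m + 1) → stdSimplex ℝ (Fin (k + 1))) : Continuous (combGauge u w) :=
  continuous_finsetSum _ fun i _ => hu.comp (continuous_comb (w i))

/-- The rescaled value `2^{nk} Ũ(2⁻ⁿ S)` is the tail from index `n` of the convergent series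
defining `Ũ_S`. -/
theorem isDini_summedGauge {U : Germ D k} (hU : IsStrongDini (k : ℝ) U) :
    IsDini (k : ℝ) (summedGauge (k : ℝ) U) := by
  refine ⟨fun S => tsum_nonneg fun n => mul_nonneg (by positivity) (hU.1.1 _), fun S S' h => ?_,
    fun S => ?_⟩
  · simp only [summedGauge, hU.1.2.1 _ _ (h.scale _)]
  · have h := hU.2 S
    have e : ∀ n : ℕ, (2 : ℝ) ^ ((n : ℝ) * (k : ℝ)) * summedGauge (k : ℝ) U (S.scale n) =
        ∑' i : ℕ, (2 : ℝ) ^ (((i + n : ℕ) : ℝ) * (k : ℝ)) * U (S.scale (i + n)) := fun n => by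
      rw [summedGauge, ← tsum_mul_left]
      refine tsum_congr fun i => ?_
      rw [hU.1.2.1.scale_scale, two_rpow_mul, two_rpow_mul, two_rpow_mul, pow_add, add_comm n i]
      ring
    simp only [e]
    exact tendsto_sum_nat_add fun n : ℕ => (2 : ℝ) ^ ((n : ℝ) * (k : ℝ)) * U (S.scale n)

theorem gaugeNorm_le {v ω : Germ D k} {c : ℝ≥0} (h : ∀ S, |ω S| ≤ c * v S) :
    gaugeNorm v ω ≤ c :=
  iInf₂_le c h

theorem Near.exists_le {v ω η : Germ D k} (h : Near v ω η) :
    ∃ c : ℝ≥0, ∀ S, |ω S - η S| ≤ c * v S := by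
  rw [Near, gaugeNorm, iInf_lt_iff] at h
  obtain ⟨c, h⟩ := h
  rw [iInf_lt_iff] at h
  exact ⟨c, h.1⟩

theorem near_of_le {v ω η : Germ D k} {c : ℝ≥0} (h : ∀ S, |ω S - η S| ≤ c * v S) :
    Near v ω η :=
  (gaugeNorm_le h).trans_lt ENNReal.coe_lt_top

end Gauges

/-! ### Dyadic sums and their growth -/

section Dyadic

variable {d : ℕ} {D : Set (Space d)} {k : ℕ}

theorem corner_isCopy (S : Simplices D k) (j : Fin (k + 1)) : IsCopy (1 / 2) S (S.corner j) := by
  refine ⟨(1 / 2 : ℝ) • S.1 j, fun i => ?_⟩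
  simp only [Simplices.corner, Simplices.inside, midpoint_eq_smul_add, invOf_eq_inv]
  module

theorem medial_isCopy (S : Simplices D 2) : IsCopy (-(1 / 2)) S S.medial := by
  refine ⟨(1 / 2 : ℝ) • (S.1 0 + S.1 1 + S.1 2), fun i => ?_⟩
  fin_cases i <;>
    simp [Simplices.medial, Simplices.inside, midpoint_eq_smul_add] <;> module

theorem continuous_corner (j : Fin (k + 1)) :
    Continuous fun S : Simplices D k => S.corner j :=
  Continuous.subtype_mk (continuous_pi fun i => continuous_midpoint j i) _

theorem continuous_medial : Continuous fun S : Simplices D 2 => S.medial := by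
  refine Continuous.subtype_mk (continuous_pi fun i => ?_) _
  fin_cases i
  exacts [continuous_midpoint 1 2, continuous_midpoint 0 2, continuous_midpoint 0 1]

/-- The dyadic decomposition consists of `2 ^ k` half-size copies. -/
theorem exists_dyadic_eq_sum (D : Set (Space d)) (hk : k = 1 ∨ k = 2) :
    ∃ c : Fin (2 ^ k) → Simplices D k → Simplices D k, (∀ i, Continuous (c i)) ∧
      (∀ i S, ∃ s : ℝ, |s| = 1 / 2 ∧ IsCopy s S (c i S)) ∧
      ∀ (ω : Germ D k) S, dyadic ω S = ∑ i, ω (c i S) := by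
  have h2 : |(1 / 2 : ℝ)| = 1 / 2 := abs_of_pos (by norm_num)
  rcases hk with rfl | rfl
  · exact ⟨fun i S => S.corner i, fun i => continuous_corner i,
      fun i S => ⟨1 / 2, h2, corner_isCopy S i⟩, fun ω S => rfl⟩
  · refine ⟨(![fun S => S.corner 0, fun S => S.corner 1, fun S => S.corner 2, fun S => S.medial] :
      Fin 4 → Simplices D 2 → Simplices D 2), ?_, ?_, ?_⟩
    · intro i
      change Fin 4 at i
      fin_cases i
      exacts [continuous_corner 0, continuous_corner 1, continuous_corner 2, continuous_medial]
    · intro i S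
      change Fin 4 at i
      fin_cases i
      exacts [⟨1 / 2, h2, corner_isCopy S 0⟩, ⟨1 / 2, h2, corner_isCopy S 1⟩,
        ⟨1 / 2, h2, corner_isCopy S 2⟩, ⟨-(1 / 2), by rw [abs_neg, h2], medial_isCopy S⟩]
    · intro ω S
      change (∑ j, ω (S.corner j)) + ω S.medial = ∑ i : Fin 4, _
      rw [Fin.sum_univ_three, Fin.sum_univ_four]
      rfl

theorem dyadicSum_zero (ω : Germ D k) : dyadicSum 0 ω = ω := rfl

theorem dyadicSum_succ (n : ℕ) (ω : Germ D k) :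
    dyadicSum (n + 1) ω = dyadicSum n (dyadic ω) := rfl

theorem dyadicSum_succ' (n : ℕ) (ω : Germ D k) :
    dyadicSum (n + 1) ω = dyadic (dyadicSum n ω) :=
  Function.iterate_succ_apply' _ _ _

theorem dyadic_sub (hk : k = 1 ∨ k = 2) (ω η : Germ D k) :
    dyadic (ω - η) = dyadic ω - dyadic η := by
  obtain ⟨c, -, -, hc⟩ := exists_dyadic_eq_sum D hk
  funext S
  simp only [Pi.sub_apply, hc, Finset.sum_sub_distrib]

theorem dyadicSum_sub (hk : k = 1 ∨ k = 2) (n : ℕ) (ω η : Germ D k) :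
    dyadicSum n (ω - η) = dyadicSum n ω - dyadicSum n η := by
  induction n generalizing ω η with
  | zero => rfl
  | succ n ih => rw [dyadicSum_succ, dyadic_sub hk, ih]; rfl

theorem continuous_dyadicSum (hk : k = 1 ∨ k = 2) {ω : Germ D k} (hω : Continuous ω) (n : ℕ) :
    Continuous (dyadicSum n ω) := by
  obtain ⟨c, hcc, -, hc⟩ := exists_dyadic_eq_sum D hk
  induction n generalizing ω with
  | zero => exact hω
  | succ n ih =>
    rw [dyadicSum_succ]
    refine ih ?_
    have : dyadic ω = fun S => ∑ i, ω (c i S) := funext (hc ω)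
    rw [this]
    exact continuous_finsetSum _ fun i _ => hω.comp (hcc i)

/-- All `2^{kn}` pieces are copies of `S` with scale factor `±2⁻ⁿ`, and `U` takes the same value on
each of them. -/
theorem abs_dyadicSum_le (hk : k = 1 ∨ k = 2) {ψ U : Germ D k} (hU : IsUniform U)
    (h : ∀ S, |ψ S| ≤ U S) (n : ℕ) (S : Simplices D k) :
    |dyadicSum n ψ S| ≤ ((2 : ℝ) ^ k) ^ n * U (S.scale n) := by
  obtain ⟨c, -, hcopy, hc⟩ := exists_dyadic_eq_sum D hk
  induction n generalizing ψ U S with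
  | zero =>
    rw [pow_zero, one_mul, dyadicSum_zero]
    refine (h S).trans (hU _ _ ?_).le
    exact (show IsCopy 1 S S from ⟨0, fun i => by module⟩).areIsometric (scale_isCopy S 0)
      (by simp)
  | succ n ih =>
    rw [dyadicSum_succ]
    refine (ih (ψ := dyadic ψ) (U := fun S => (2 : ℝ) ^ k * U (S.scale 1)) ?_ ?_ S).trans ?_
    · intro S S' hS
      simp only [hU _ _ (hS.scale 1)]
    · intro S
      rw [hc]
      refine (Finset.abs_sum_le_sum_abs _ _).trans ?_
      calc ∑ i, |ψ (c i S)| ≤ ∑ _i : Fin (2 ^ k), U (S.scale 1) := by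
            refine Finset.sum_le_sum fun i _ => (h _).trans ?_
            obtain ⟨s, hs, hcp⟩ := hcopy i S
            exact (hU.eq_scale_of_isCopy hcp (by rw [hs, pow_one])).le
        _ = (2 : ℝ) ^ k * U (S.scale 1) := by simp
    · rw [hU.scale_scale, pow_succ]
      exact (mul_assoc _ _ _).symm.le

theorem vol_eq_zero_of_isCopy {s : ℝ} {S S' : Simplices D k} (h : IsCopy s S S') (hS : vol S = 0) :
    vol S' = 0 := by
  obtain ⟨q, hq⟩ := h
  -- Since `Real.sqrt` vanishes exactly on nonpositive numbers, only the sign of the determinant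
  -- matters, and scaling multiplies it by `(s * s)^k ≥ 0`.
  have hfac : (1 : ℝ) / (k.factorial : ℝ) ≠ 0 := by positivity
  simp only [vol, mul_eq_zero, hfac, false_or, Real.sqrt_eq_zero'] at hS ⊢
  have e : (Matrix.of fun (i : Fin k) (j : Fin d) => (S'.1 i.succ - S'.1 0) j) =
      s • Matrix.of fun (i : Fin k) (j : Fin d) => (S.1 i.succ - S.1 0) j := by
    ext i j
    simp only [hq, Matrix.of_apply, Matrix.smul_apply, PiLp.sub_apply, PiLp.add_apply,
      PiLp.smul_apply, smul_eq_mul]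
    ring
  rw [e, Matrix.transpose_smul, Matrix.smul_mul, Matrix.mul_smul, smul_smul, Matrix.det_smul]
  exact mul_nonpos_of_nonneg_of_nonpos (pow_nonneg (mul_self_nonneg s) _) hS

theorem IsNonatomic.dyadicSum (hk : k = 1 ∨ k = 2) {ω : Germ D k} (hω : IsNonatomic ω) (n : ℕ) :
    IsNonatomic (dyadicSum n ω) := by
  obtain ⟨c, -, hcopy, hc⟩ := exists_dyadic_eq_sum D hk
  induction n generalizing ω with
  | zero => exact hω
  | succ n ih =>
    refine ih fun S hS => ?_
    rw [hc]
    refine Finset.sum_eq_zero fun i _ => hω _ ?_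
    obtain ⟨s, -, hcp⟩ := hcopy i S
    exact vol_eq_zero_of_isCopy hcp hS

end Dyadic

/-! ### Convergence of the dyadic sums -/

section Limit

variable {d : ℕ} {D : Set (Space d)} {k : ℕ}

/-- By linearity the increment is the `n`-th dyadic sum of `dya ω - ω`, to which the growth bound
applies. -/
theorem dist_dyadicSum_le (hk : k = 1 ∨ k = 2) {U ω : Germ D k} (hU : IsUniform U) {c : ℝ}
    (h : ∀ S, |dyadic ω S - ω S| ≤ c * U S) (S : Simplices D k) (n : ℕ) :
    dist (dyadicSum n ω S) (dyadicSum n.succ ω S) ≤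
      c * ((2 : ℝ) ^ ((n : ℝ) * (k : ℝ)) * U (S.scale n)) := by
  rw [dist_comm, Real.dist_eq, Nat.succ_eq_add_one, dyadicSum_succ, ← Pi.sub_apply,
    ← dyadicSum_sub hk]
  refine (abs_dyadicSum_le hk (U := fun S => c * U S) (fun S S' hS => ?_) h n S).trans ?_
  · simp only [hU S S' hS]
  · rw [two_rpow_mul]
    exact (mul_left_comm _ _ _).le

theorem abs_sub_le_summedGauge (hk : k = 1 ∨ k = 2) {U ω η : Germ D k}
    (hU : IsStrongDini (k : ℝ) U) {c : ℝ} (h : ∀ S, |dyadic ω S - ω S| ≤ c * U S)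
    (hlim : ∀ S, Tendsto (fun n => dyadicSum n ω S) atTop (𝓝 (η S))) (S : Simplices D k) :
    |ω S - η S| ≤ c * summedGauge (k : ℝ) U S := by
  have := dist_le_tsum_of_dist_le_of_tendsto₀ _ (dist_dyadicSum_le hk hU.1.2.1 h S)
    ((hU.2 S).mul_left c) (hlim S)
  rwa [tsum_mul_left, Real.dist_eq] at this

theorem exists_limit (hk : k = 1 ∨ k = 2) {U ω : Germ D k} (hU : IsStrongDini (k : ℝ) U)
    (hUc : Continuous U) (hUs : Continuous (summedGauge (k : ℝ) U)) (hω : Continuous ω) {c : ℝ}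
    (hc : 0 ≤ c) (h : ∀ S, |dyadic ω S - ω S| ≤ c * U S) :
    ∃ η : Germ D k, Continuous η ∧ dyadic η = η ∧
      ∀ S, Tendsto (fun n => dyadicSum n ω S) atTop (𝓝 (η S)) := by
  have hstep := dist_dyadicSum_le hk hU.1.2.1 h
  have hsum : ∀ S : Simplices D k, Summable fun n : ℕ => c * ((2 : ℝ) ^ ((n : ℝ) * (k : ℝ)) * U (S.scale n)) :=
    fun S => (hU.2 S).mul_left c
  choose η hη using fun S => cauchySeq_tendsto_of_complete
    (cauchySeq_of_dist_le_of_summable _ (hstep S) (hsum S))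
  refine ⟨η, ?_, ?_, hη⟩
  -- The tail of the series dominates the distance to the limit. It is continuous because `Ũ` and
  -- the partial sums are, and it decreases to `0`; as in Dini's theorem, a bound at `S` for one `n`
  -- persists near `S` for all larger indices. So convergence is locally uniform.
  · set T : ℕ → Germ D k := fun n (S : Simplices D k) => c * (summedGauge (k : ℝ) U S -
      ∑ i ∈ Finset.range n, (2 : ℝ) ^ ((i : ℝ) * (k : ℝ)) * U (S.scale i)) with hT
    have hTc : ∀ n, Continuous (T n) := fun n => continuous_const.mul (hUs.sub
      (continuous_finsetSum _ fun i _ => continuous_const.mul (hUc.comp (continuous_scale i))))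
    have hTn : ∀ n m S, n ≤ m → T m S ≤ T n S := fun n m S hnm => by
      simp only [hT]
      gcongr
      · exact fun i _ _ => mul_nonneg (by positivity) (hU.1.1 _)
    have hTd : ∀ n S, dist (dyadicSum n ω S) (η S) ≤ T n S := fun n S => by
      refine (dist_le_tsum_of_dist_le_of_tendsto _ (hstep S) (hsum S) (hη S) n).trans ?_
      rw [tsum_mul_left, hT]
      simp only [summedGauge, ← (hU.2 S).sum_add_tsum_nat_add n, add_comm n]
      rw [add_sub_cancel_left]
    have hT0 : ∀ S, Tendsto (fun n => T n S) atTop (𝓝 0) := fun S => by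
      have := ((hU.2 S).hasSum.tendsto_sum_nat.const_sub (summedGauge (k : ℝ) U S)).const_mul c
      rwa [show summedGauge (k : ℝ) U S - ∑' n : ℕ, (2 : ℝ) ^ ((n : ℝ) * (k : ℝ)) * U (S.scale n)
        = 0 from sub_self _, mul_zero] at this
    have hloc : TendstoLocallyUniformly (fun n => dyadicSum n ω) η atTop := by
      rw [Metric.tendstoLocallyUniformly_iff]
      intro ε hε S
      obtain ⟨n, hn⟩ := ((hT0 S).eventually_lt_const hε).exists
      refine ⟨{S' | T n S' < ε}, (hTc n).continuousAt.eventually_lt_const hn,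
        eventually_atTop.2 ⟨n, fun m hm S' hS' => ?_⟩⟩
      rw [dist_comm]
      exact (hTd m S').trans_lt ((hTn n m S' hm).trans_lt hS')
    exact hloc.continuous (Frequently.of_forall fun n => continuous_dyadicSum hk hω n)
  · obtain ⟨c, -, -, hc⟩ := exists_dyadic_eq_sum D hk
    funext S
    refine tendsto_nhds_unique (f := fun n => dyadicSum (n + 1) ω S) ?_
      ((hη S).comp (tendsto_add_atTop_nat 1))
    simp only [dyadicSum_succ', hc]
    exact tendsto_finsetSum _ fun i _ => hη (c i S)

end Limit

/-! ### Germs as functions of points -/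

section Values

variable {d : ℕ} {D : Set (Space d)} {k : ℕ}

open Classical in
/-- The value of a germ at a tuple of points, and `0` if this is not a simplex in `D`. -/
noncomputable def value (ω : Germ D k) (q : Fin (k + 1) → Space d) : ℝ :=
  if h : convexHull ℝ (Set.range q) ⊆ D then ω ⟨q, h⟩ else 0

theorem value_coe (ω : Germ D k) (S : Simplices D k) : value ω S.1 = ω S :=
  dif_pos S.2

theorem value_eq (ω : Germ D k) (S : Simplices D k) {q : Fin (k + 1) → Space d} (h : S.1 = q) :
    ω S = value ω q := by
  rw [← h, value_coe]

theorem vec_two_eta {α : Type*} (q : Fin 2 → α) : q = ![q 0, q 1] := by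
  ext i; fin_cases i <;> rfl

theorem vec_three_eta {α : Type*} (q : Fin 3 → α) : q = ![q 0, q 1, q 2] := by
  ext i; fin_cases i <;> rfl

/-- The value of a `1`-germ at two points. -/
noncomputable def segmentValue (ω : Germ D 1) (a b : Space d) : ℝ := value ω ![a, b]

/-- The value of a `2`-germ at three points. -/
noncomputable def triangleValue (ω : Germ D 2) (a b c : Space d) : ℝ := value ω ![a, b, c]

theorem eq_segmentValue (ω : Germ D 1) (S : Simplices D 1) :
    ω S = segmentValue ω (S.1 0) (S.1 1) :=
  value_eq ω S (vec_two_eta _)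

theorem eq_triangleValue (ω : Germ D 2) (S : Simplices D 2) :
    ω S = triangleValue ω (S.1 0) (S.1 1) (S.1 2) :=
  value_eq ω S (vec_three_eta _)

theorem coboundary_eq_segmentValue (ω : Germ D 1) (T : Simplices D 2) :
    coboundary ω T = segmentValue ω (T.1 1) (T.1 2) - segmentValue ω (T.1 0) (T.1 2) +
      segmentValue ω (T.1 0) (T.1 1) := by
  refine (Fin.sum_univ_three fun i : Fin 3 => (-1 : ℝ) ^ (i : ℕ) * ω (T.face i)).trans ?_
  have h1 : (T.face 0).1 = ![T.1 1, T.1 2] := by ext i; fin_cases i <;> rfl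
  have h2 : (T.face 1).1 = ![T.1 0, T.1 2] := by ext i; fin_cases i <;> rfl
  have h3 : (T.face 2).1 = ![T.1 0, T.1 1] := by ext i; fin_cases i <;> rfl
  rw [value_eq ω _ h1, value_eq ω _ h2, value_eq ω _ h3]
  simp only [segmentValue]
  norm_num
  ring

theorem coboundary_eq_delta (ω : Germ D 2) (T : Simplices D 3) :
    coboundary ω T = delta (triangleValue ω) (T.1 0) (T.1 1) (T.1 2) (T.1 3) := by
  refine (Fin.sum_univ_four fun i : Fin 4 => (-1 : ℝ) ^ (i : ℕ) * ω (T.face i)).trans ?_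
  have h1 : (T.face 0).1 = ![T.1 1, T.1 2, T.1 3] := by ext i; fin_cases i <;> rfl
  have h2 : (T.face 1).1 = ![T.1 0, T.1 2, T.1 3] := by ext i; fin_cases i <;> rfl
  have h3 : (T.face 2).1 = ![T.1 0, T.1 1, T.1 3] := by ext i; fin_cases i <;> rfl
  have h4 : (T.face 3).1 = ![T.1 0, T.1 1, T.1 2] := by ext i; fin_cases i <;> rfl
  rw [value_eq ω _ h1, value_eq ω _ h2, value_eq ω _ h3, value_eq ω _ h4]
  simp only [delta, triangleValue]
  norm_num
  ring

theorem dyadic_eq_segmentValue (ω : Germ D 1) (S : Simplices D 1) {z : Space d}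
    (hz : z = midpoint ℝ (S.1 0) (S.1 1)) :
    dyadic ω S = segmentValue ω (S.1 0) z + segmentValue ω z (S.1 1) := by
  change ∑ j, ω (S.corner j) = _
  rw [Fin.sum_univ_two, hz]
  simp [eq_segmentValue, Simplices.corner, Simplices.inside, midpoint_comm (S.1 1)]

theorem dyadic_eq_triangleValue (ω : Germ D 2) (S : Simplices D 2) {x y z : Space d}
    (hx : x = midpoint ℝ (S.1 1) (S.1 2)) (hy : y = midpoint ℝ (S.1 0) (S.1 2))
    (hz : z = midpoint ℝ (S.1 0) (S.1 1)) :
    dyadic ω S = triangleValue ω (S.1 0) z y + triangleValue ω z (S.1 1) x +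
      triangleValue ω y x (S.1 2) + triangleValue ω x y z := by
  change ∑ j, ω (S.corner j) + ω S.medial = _
  rw [Fin.sum_univ_three, hx, hy, hz]
  simp [eq_triangleValue, Simplices.corner, Simplices.medial, Simplices.inside,
    midpoint_comm (S.1 1) (S.1 0), midpoint_comm (S.1 2)]

theorem IsNonatomic.segmentValue_self {ω : Germ D 1} (hω : IsNonatomic ω) (a : Space d) :
    segmentValue ω a a = 0 := by
  unfold segmentValue value
  split_ifs with h
  · refine hω _ ?_
    simp [vol, Matrix.mul_apply]
  · rfl

theorem IsNonatomic.triangleValue_eq_zero {ω : Germ D 2} (hω : IsNonatomic ω) {a b c : Space d}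
    (p w : Space d) (x y z : ℝ) (ha : a = p + x • w) (hb : b = p + y • w) (hc : c = p + z • w) :
    triangleValue ω a b c = 0 := by
  unfold triangleValue value
  split_ifs with h
  · refine hω _ ?_
    have e1 : ∀ j, (b - a) j = (y - x) * w j := fun j => by
      simp only [ha, hb, PiLp.sub_apply, PiLp.add_apply, PiLp.smul_apply, smul_eq_mul]; ring
    have e2 : ∀ j, (c - a) j = (z - x) * w j := fun j => by
      simp only [ha, hc, PiLp.sub_apply, PiLp.add_apply, PiLp.smul_apply, smul_eq_mul]; ring
    simp only [vol, Matrix.det_fin_two, Matrix.mul_apply, Matrix.transpose_apply, Matrix.of_apply,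
      Fin.succ_zero_eq_one, Fin.succ_one_eq_two, Matrix.cons_val_zero, Matrix.cons_val_one,
      Matrix.cons_val, e1, e2]
    have e3 : ∀ s t : ℝ, ∑ j, s * w j * (t * w j) = s * t * ∑ j, w j * w j := fun s t => by
      rw [Finset.mul_sum]
      exact Finset.sum_congr rfl fun j _ => by ring
    simp only [e3]
    rw [mul_eq_zero, Real.sqrt_eq_zero']
    exact Or.inr (by ring_nf; rfl)
  · rfl

end Values

/-! ### One subdivision step in terms of the coboundary -/

section Identity

variable {d : ℕ} {D : Set (Space d)} {k : ℕ}

/-- The vertices of the standard simplex. -/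
def vert {n : ℕ} (i : Fin n) : stdSimplex ℝ (Fin n) :=
  ⟨Pi.single i 1, single_mem_stdSimplex ℝ i⟩

/-- The midpoints of the edges of the standard simplex. -/
noncomputable def edgeMid {n : ℕ} (i j : Fin n) : stdSimplex ℝ (Fin n) :=
  ⟨midpoint ℝ (Pi.single i 1) (Pi.single j 1),
    (convex_stdSimplex ℝ _).segment_subset (single_mem_stdSimplex ℝ i) (single_mem_stdSimplex ℝ j)
      (midpoint_mem_segment _ _)⟩

theorem sum_vert_smul {n : ℕ} (i : Fin n) (p : Fin n → Space d) :
    ∑ j, (vert i).1 j • p j = p i := by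
  simp [vert, Pi.single_apply]

theorem sum_edgeMid_smul {n : ℕ} (i j : Fin n) (p : Fin n → Space d) :
    ∑ l, (edgeMid i j).1 l • p l = midpoint ℝ (p i) (p j) := by
  simp [edgeMid, midpoint_eq_smul_add, Pi.single_apply, add_smul, Finset.sum_add_distrib]

/-- `dya ω - ω` is a fixed combination of values of `δω` at simplices inside the given one. -/
theorem exists_dyadic_sub_eq (D : Set (Space d)) (hk : k = 1 ∨ k = 2) :
    ∃ (N : ℕ) (w : Fin N → Fin (k + 1 + 1) → stdSimplex ℝ (Fin (k + 1))) (ε : Fin N → ℝ),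
      (∀ i, |ε i| = 1) ∧ ∀ ω : Germ D k, IsNonatomic ω → ∀ S,
        dyadic ω S - ω S = ∑ i, ε i * coboundary ω (S.comb (w i)) := by
  rcases hk with rfl | rfl
  · refine ⟨1, fun _ => ![vert 0, edgeMid 0 1, vert 1], fun _ => 1, fun _ => abs_one,
      fun ω _ S => ?_⟩
    rw [dyadic_eq_segmentValue ω S rfl, eq_segmentValue ω S]
    simp only [Fin.sum_univ_one, coboundary_eq_segmentValue, Simplices.comb, Simplices.inside,
      Matrix.cons_val_zero, Matrix.cons_val_one, Matrix.cons_val, sum_vert_smul, sum_edgeMid_smul]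
    ring
  -- The first four flat tetrahedra account for the subdivision up to the order of vertices of
  -- triangles at `p₀`. The last three have a repeated vertex and perform the required
  -- transpositions, since `ω` itself need not be alternating.
  · refine ⟨7, ![![vert 0, edgeMid 0 1, vert 1, edgeMid 1 2],
      ![vert 0, edgeMid 0 2, edgeMid 1 2, vert 2], ![vert 0, edgeMid 1 2, edgeMid 0 2, edgeMid 0 1],
      ![vert 0, vert 1, edgeMid 1 2, vert 2], ![vert 0, edgeMid 0 1, edgeMid 0 2, edgeMid 0 1],
      ![vert 0, edgeMid 0 1, edgeMid 1 2, edgeMid 0 1],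
      ![vert 0, edgeMid 0 2, edgeMid 1 2, edgeMid 0 2]], ![1, 1, 1, -1, -1, 1, -1], ?_, ?_⟩
    · intro i
      fin_cases i <;> simp
    · intro ω hω S
      rw [dyadic_eq_triangleValue ω S rfl rfl rfl, eq_triangleValue ω S]
      simp only [Fin.sum_univ_seven, coboundary_eq_delta, Simplices.comb, Simplices.inside,
        Matrix.cons_val_zero, Matrix.cons_val_one, Matrix.cons_val, sum_vert_smul,
        sum_edgeMid_smul, delta]
      generalize S.1 0 = a, S.1 1 = b, S.1 2 = c
      generalize hx : midpoint ℝ b c = x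
      generalize hy : midpoint ℝ a c = y
      generalize hz : midpoint ℝ a b = z
      rw [midpoint_eq_smul_add, invOf_eq_inv] at hx hy hz
      have outer : ∀ p q, triangleValue ω p q p = 0 := fun p q =>
        hω.triangleValue_eq_zero p (q - p) 0 1 0 (by module) (by module) (by module)
      have h1 : triangleValue ω a z b = 0 :=
        hω.triangleValue_eq_zero a (b - a) 0 (1 / 2) 1 (by module) (by rw [← hz]; module)
          (by module)
      have h2 : triangleValue ω a y c = 0 :=
        hω.triangleValue_eq_zero a (c - a) 0 (1 / 2) 1 (by module) (by rw [← hy]; module)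
          (by module)
      have h3 : triangleValue ω b x c = 0 :=
        hω.triangleValue_eq_zero b (c - b) 0 (1 / 2) 1 (by module) (by rw [← hx]; module)
          (by module)
      have right : ∀ p q, triangleValue ω p q q = 0 := fun p q =>
        hω.triangleValue_eq_zero p (q - p) 0 1 1 (by module) (by module) (by module)
      simp only [h1, h2, h3, outer, right]
      ring

end Identity

/-! ### Closedness on planes and uniqueness -/

section Closed

variable {d : ℕ} {D : Set (Space d)} {k : ℕ}

theorem coboundary_pullback {n : ℕ} {I : Set (Space n)} (φ : Space n →ᵃ[ℝ] Space d)
    (h : Set.MapsTo φ I D) (ω : Germ D k) (T : Simplices I (k + 1)) :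
    coboundary (pullback φ h ω) T = coboundary ω (T.push φ h) := rfl

/-- A simplex is the affine image of a simplex in the parameter space. -/
theorem coboundary_comb_eq_zero {ω : Germ D k} (hω : IsClosedOnPlanes ω) (S : Simplices D k)
    (w : Fin (k + 1 + 1) → stdSimplex ℝ (Fin (k + 1))) : coboundary ω (S.comb w) = 0 := by
  let φ : Space k →ᵃ[ℝ] Space d := ((Fintype.linearCombination ℝ
    (fun i : Fin k => S.1 i.succ - S.1 0)) ∘ₗ
      (WithLp.linearEquiv 2 ℝ (Fin k → ℝ)).toLinearMap).toAffineMap +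
    AffineMap.const ℝ (Space k) (S.1 0)
  let s : Fin (k + 1) → Space k := Fin.cons 0 fun i => EuclideanSpace.single i 1
  have hs : ∀ i, φ (s i) = S.1 i := by
    intro i
    refine Fin.cases ?_ (fun i => ?_) i
    · simp [φ, s]
    · simp [φ, s, Fintype.linearCombination_apply, Pi.single_apply]
  have hφ : Set.MapsTo φ (convexHull ℝ (Set.range s)) D := by
    rw [Set.mapsTo_iff_image_subset, AffineMap.image_convexHull, ← Set.range_comp]
    have : φ ∘ s = S.1 := funext hs
    rw [this]
    exact S.2
  have e : S.comb w = Simplices.push φ hφ (Simplices.comb ⟨s, subset_rfl⟩ w) := by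
    refine Subtype.ext (funext fun i => ?_)
    have hd : ∀ x, φ x = φ.linear x + φ 0 := fun x => congrFun φ.decomp x
    change ∑ j, (w i).1 j • S.1 j = φ (∑ j, (w i).1 j • s j)
    rw [hd, map_sum]
    simp only [← hs, hd (s _), smul_add, Finset.sum_add_distrib, ← Finset.sum_smul, (w i).2.2,
      one_smul, map_smul]
  rw [e, ← coboundary_pullback, hω]
  rfl

/-- The coboundaries expressing `dya ω - ω` are taken at simplices in the affine span of `S`, where
a regular germ is closed. -/
theorem IsRegular.dyadic_eq (hk : k = 1 ∨ k = 2) {ω : Germ D k} (hω : IsRegular ω) :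
    dyadic ω = ω := by
  obtain ⟨N, w, ε, -, H⟩ := exists_dyadic_sub_eq D hk
  funext S
  rw [← sub_eq_zero, H ω hω.1 S]
  exact Finset.sum_eq_zero fun i _ => by rw [coboundary_comb_eq_zero hω.2, mul_zero]

/-- The `k + 2` vertices of a simplex in `ℝ^k` are affinely dependent, and so are their affine
images. -/
theorem isClosedOnPlanes_of_coboundary {ω : Germ D k}
    (h : ∀ T : Simplices D (k + 1), ¬AffineIndependent ℝ T.1 → coboundary ω T = 0) :
    IsClosedOnPlanes ω := by
  intro I φ hφ
  funext T
  rw [coboundary_pullback]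
  refine h _ fun hT => ?_
  have h1 : AffineIndependent ℝ T.1 := AffineIndependent.of_comp φ hT
  have := h1.card_le_finrank_succ
  have h2 : Module.finrank ℝ (vectorSpan ℝ (Set.range T.1)) ≤ k :=
    (Submodule.finrank_le _).trans (by simp)
  simp only [Fintype.card_fin] at this
  omega

/-- A continuous function of the vertices inside a convex subset of `D`. -/
theorem continuousOn_value {ω : Germ D k} (hω : Continuous ω) {X : Type*} [TopologicalSpace X]
    {A : Set X} {q : X → Fin (k + 1) → Space d} (hq : Continuous q)
    (h : ∀ x ∈ A, convexHull ℝ (Set.range (q x)) ⊆ D) :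
    ContinuousOn (fun x => value ω (q x)) A := by
  rw [continuousOn_iff_continuous_domRestrict]
  have : A.domRestrict (fun x => value ω (q x)) =
      fun x : A => ω ⟨q x, h x x.2⟩ := by
    funext x
    exact dif_pos _
  rw [this]
  exact hω.comp (Continuous.subtype_mk (hq.comp continuous_subtype_val) _)

/-- This turns the `k`-Dini condition on a dominating gauge into the hypothesis of `Small.eq_zero`
with `r = 2^k`; uniformity makes one sequence serve all copies at a given scale. -/
theorem small_coboundary {η : Germ D k} {G : Germ D (k + 1)} (hG : IsDini (k : ℝ) G)
    (hle : ∀ T, |coboundary η T| ≤ G T) {K : Set (Space d)} (hK : Convex ℝ K) (hKD : K ⊆ D)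
    {f : Space d → (Fin (k + 1 + 1) → Space d) → ℝ}
    (hf : ∀ (T : Simplices D (k + 1)) p V, (∀ i, T.1 i = p + V i) → f p V = coboundary η T) :
    Small (2 ^ k) (fun p (V : Fin (k + 1 + 1) → Space d) => ∀ i, p + V i ∈ K) f := by
  have hD : ∀ p (V : Fin (k + 1 + 1) → Space d), (∀ i, p + V i ∈ K) →
      convexHull ℝ (Set.range fun i => p + V i) ⊆ D := fun p V h =>
    (convexHull_min (Set.range_subset_iff.2 h) hK).trans hKD
  intro p V h
  let T : Simplices D (k + 1) := ⟨fun i => p + V i, hD p V h⟩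
  refine ⟨_, hG.2.2 T, fun n s q hs hq => ?_⟩
  let T' : Simplices D (k + 1) := ⟨fun i => q + (s • V) i, hD q _ hq⟩
  have hc : IsCopy s T T' := ⟨q - s • p, fun i => by
    change q + s • V i = q - s • p + s • (p + V i)
    module⟩
  rw [hf T' q (s • V) fun i => rfl, two_rpow_mul, ← hG.2.1.eq_scale_of_isCopy hc hs]
  push_cast
  exact mul_le_mul_of_nonneg_left (hle T') (by positivity)

theorem isClosedOnPlanes_of_dyadic (hk : k = 1 ∨ k = 2) {η : Germ D k} (hη : Continuous η)
    (hna : IsNonatomic η) (hdya : dyadic η = η) {G : Germ D (k + 1)} (hG : IsDini (k : ℝ) G)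
    (hle : ∀ T, |coboundary η T| ≤ G T) : IsClosedOnPlanes η := by
  refine isClosedOnPlanes_of_coboundary fun T hT => ?_
  have hKD := T.2
  have hK := convex_convexHull ℝ (Set.range T.1)
  have hTK := T.vertex_mem
  -- The set `D` need not be convex, so the argument runs inside the hull of `T`, which contains
  -- every subdivision used.
  generalize convexHull ℝ (Set.range T.1) = K at hKD hK hTK
  have hull : ∀ {n : ℕ} (q : Fin n → Space d), (∀ i, q i ∈ K) →
      convexHull ℝ (Set.range q) ⊆ D := fun q hq =>
    (convexHull_min (Set.range_subset_iff.2 hq) hK).trans hKD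
  rcases hk with rfl | rfl
  · have hN : SewnSegments K (segmentValue η) :=
      { convex := hK
        degenerate := fun a _ => hna.segmentValue_self a
        dyadic := fun a ha b hb z hz => by
          let S : Simplices D 1 := ⟨![a, b], hull _ fun i => by fin_cases i <;> assumption⟩
          have h1 := dyadic_eq_segmentValue η S (z := z)
            (by rw [hz, midpoint_eq_smul_add, invOf_eq_inv, one_div]; rfl)
          rw [hdya, eq_segmentValue η S] at h1
          exact h1
        small := small_coboundary hG hle hK hKD fun T p V hV => by
          rw [coboundary_eq_segmentValue, hV, hV, hV]
        continuousOn := continuousOn_value hη (q := fun x : Space d × Space d => ![x.1, x.2])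
          (by refine continuous_pi fun i => ?_; fin_cases i; exacts [continuous_fst, continuous_snd])
          fun x hx => hull _ fun i => by fin_cases i; exacts [hx.1, hx.2] }
    rw [coboundary_eq_segmentValue]
    refine hN.closed (hTK 0) (hTK 1) (hTK 2) ?_
    rw [collinear_iff_not_affineIndependent_set]
    have e : T.1 = ![T.1 0, T.1 1, T.1 2] := vec_three_eta T.1
    rwa [← e]
  · have hN : SewnTriangles K (triangleValue η) :=
      { convex := hK
        degenerate := fun a _ b _ c _ p w x y z => hna.triangleValue_eq_zero p w x y z
        dyadic := fun a ha b hb c hc x y z hx hy hz => by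
          let S : Simplices D 2 := ⟨![a, b, c], hull _ fun i => by fin_cases i <;> assumption⟩
          have h1 := dyadic_eq_triangleValue η S (x := x) (y := y) (z := z)
            (by rw [hx, midpoint_eq_smul_add, invOf_eq_inv, one_div]; rfl)
            (by rw [hy, midpoint_eq_smul_add, invOf_eq_inv, one_div]; rfl)
            (by rw [hz, midpoint_eq_smul_add, invOf_eq_inv, one_div]; rfl)
          rw [hdya, eq_triangleValue η S] at h1
          exact h1
        small := small_coboundary hG hle hK hKD fun T p V hV => by
          rw [coboundary_eq_delta, hV, hV, hV, hV]
        continuousOn := continuousOn_value hη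
          (q := fun x : Space d × Space d × Space d => ![x.1, x.2.1, x.2.2])
          (by
            refine continuous_pi fun i => ?_
            fin_cases i
            exacts [continuous_fst, continuous_fst.comp continuous_snd,
              continuous_snd.comp continuous_snd])
          fun x hx => hull _ fun i => by fin_cases i; exacts [hx.1, hx.2.1, hx.2.2] }
    rw [coboundary_eq_delta]
    exact hN.closed hTK hT

theorem face_eq_comb (T : Simplices D (k + 1)) (i : Fin (k + 2)) :
    T.face i = T.comb fun j => vert (i.succAbove j) :=
  Subtype.ext (funext fun j => (sum_vert_smul (i.succAbove j) T.1).symm)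

theorem abs_coboundary_le (ω : Germ D k) (T : Simplices D (k + 1)) :
    |coboundary ω T| ≤ ∑ i, |ω (T.face i)| :=
  (Finset.abs_sum_le_sum_abs _ _).trans (Finset.sum_le_sum fun i _ => by
    rw [abs_mul, abs_pow, abs_neg, abs_one, one_pow, one_mul])

/-- A dyadically additive germ dominated by a Dini gauge vanishes. -/
theorem eq_zero_of_dyadic_eq (hk : k = 1 ∨ k = 2) {θ g : Germ D k} (hg : IsDini (k : ℝ) g)
    (hdya : dyadic θ = θ) (h : ∀ S, |θ S| ≤ g S) : θ = 0 := by
  have hn : ∀ n, dyadicSum n θ = θ := fun n => by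
    induction n with
    | zero => rfl
    | succ n ih => rw [dyadicSum_succ, hdya, ih]
  funext S
  refine abs_nonpos_iff.1 (ge_of_tendsto' (hg.2.2 S) fun n => ?_)
  rw [two_rpow_mul]
  simpa only [hn] using abs_dyadicSum_le hk hg.2.1 h n S

/-- The difference of two sewings is dyadically additive by regularity and is dominated by a
combination of the two Dini gauges. -/
theorem IsSewing.eq (hk : k = 1 ∨ k = 2) {v w ω η η' : Germ D k} (hv : IsDini (k : ℝ) v)
    (hw : IsDini (k : ℝ) w) (h : IsSewing v ω η) (h' : IsSewing w ω η') : η' = η := by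
  obtain ⟨c, hc⟩ := h.2.exists_le
  obtain ⟨c', hc'⟩ := h'.2.exists_le
  refine sub_eq_zero.1 (eq_zero_of_dyadic_eq hk
    ((hv.const_mul c.2).add (hw.const_mul c'.2)) ?_ fun S => ?_)
  · rw [dyadic_sub hk, h.1.dyadic_eq hk, h'.1.dyadic_eq hk]
  · have e : (η' - η) S = (ω S - η S) - (ω S - η' S) := by
      rw [Pi.sub_apply]; ring
    rw [e]
    exact (abs_sub _ _).trans (add_le_add (hc S) (hc' S))

end Closed

end RoughForm

/-! ### Existence, uniqueness and the sharp gauge bound -/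

theorem mainTheorem1 {d : ℕ} (D : Set (RoughForm.Space d)) (k : ℕ) (hk : k = 1 ∨ k = 2)
    (u : RoughForm.Germ D (k + 1)) (hu : RoughForm.IsStrongDini (k : ℝ) u)
    (hu_cont : Continuous u) (hu_sum : Continuous (RoughForm.summedGauge (k : ℝ) u)) :
    ∃ v : RoughForm.Germ D k, Continuous v ∧ RoughForm.IsDini (k : ℝ) v ∧
      ∀ ω : RoughForm.Germ D k, Continuous ω → RoughForm.IsNonatomic ω →
        RoughForm.Near u (RoughForm.coboundary ω) 0 →
        ∃ η : RoughForm.Germ D k, RoughForm.IsSewing v ω η ∧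
          -- `η` is the only germ that can be called `sew ω`
          (∀ w η' : RoughForm.Germ D k, RoughForm.IsDini (k : ℝ) w → RoughForm.IsSewing w ω η' →
            η' = η) ∧
          Continuous η ∧
          (∀ S : RoughForm.Simplices D k,
            Tendsto (fun n : ℕ => RoughForm.dyadicSum n ω S) atTop (𝓝 (η S))) ∧
          RoughForm.gaugeNorm v (ω - η) ≤ RoughForm.gaugeNorm u (RoughForm.coboundary ω) := by
  obtain ⟨N, w, ε, hε, hdya⟩ := RoughForm.exists_dyadic_sub_eq D hk
  -- The combinations `w` do not depend on the germ, so the resulting gauge `v = Ũ` serves all `ω`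
  -- at once.
  set U : RoughForm.Germ D k := RoughForm.combGauge u w with hU
  have hUs : RoughForm.IsStrongDini (k : ℝ) U := hu.combGauge w
  have hUsum : Continuous (RoughForm.summedGauge (k : ℝ) U) := by
    rw [hU, RoughForm.summedGauge_combGauge hu]
    exact RoughForm.continuous_combGauge hu_sum w
  have hv := RoughForm.isDini_summedGauge hUs
  refine ⟨RoughForm.summedGauge (k : ℝ) U, hUsum, hv, fun ω hω hna hnear => ?_⟩
  have hbound : ∀ c : ℝ, (∀ T, |RoughForm.coboundary ω T| ≤ c * u T) →
      ∀ S, |RoughForm.dyadic ω S - ω S| ≤ c * U S := by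
    intro c hc S
    rw [hdya ω hna S, hU, RoughForm.combGauge, Finset.mul_sum]
    refine (Finset.abs_sum_le_sum_abs _ _).trans (Finset.sum_le_sum fun i _ => ?_)
    rw [abs_mul, hε, one_mul]
    exact hc _
  obtain ⟨c, hc⟩ := hnear.exists_le
  simp only [Pi.zero_apply, sub_zero] at hc
  obtain ⟨η, hη, hηd, hlim⟩ := RoughForm.exists_limit hk hUs
    (RoughForm.continuous_combGauge hu_cont w) hUsum hω c.2 (hbound c hc)
  have hdist := RoughForm.abs_sub_le_summedGauge hk hUs (hbound c hc) hlim
  have hηna : RoughForm.IsNonatomic η := fun S hS =>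
    tendsto_nhds_unique (hlim S) (by
      simpa only [hna.dyadicSum hk _ S hS] using tendsto_const_nhds)
  have hη_closed : RoughForm.IsClosedOnPlanes η := by
    -- The dominating gauge for `δη` is `c u` plus `c v` summed over the faces, from `δη = δω - δ(ω
    -- - η)`.
    refine RoughForm.isClosedOnPlanes_of_dyadic hk hη hηna hηd
      ((hu.1.const_mul c.2).add (RoughForm.IsDini.sum Finset.univ fun i _ =>
        (hv.comb fun j => RoughForm.vert (Fin.succAbove i j)).const_mul c.2)) fun T => ?_
    have e : RoughForm.coboundary η T =
        RoughForm.coboundary ω T - RoughForm.coboundary (ω - η) T := by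
      simp only [RoughForm.coboundary, Pi.sub_apply, mul_sub, Finset.sum_sub_distrib]
      ring
    rw [e]
    refine (abs_sub _ _).trans (add_le_add (hc T)
      ((RoughForm.abs_coboundary_le _ _).trans (Finset.sum_le_sum fun i _ => ?_)))
    rw [← RoughForm.face_eq_comb]
    exact hdist _
  have hsew : RoughForm.IsSewing (RoughForm.summedGauge (k : ℝ) U) ω η :=
    ⟨⟨hηna, hη_closed⟩, RoughForm.near_of_le hdist⟩
  refine ⟨η, hsew, fun w' η' hw' h' => hsew.eq hk hv hw' h', hη, hlim, ?_⟩
  -- Every constant admissible for `δω` is admissible for `ω - η`, since the signs in the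
  -- subdivision identity have absolute value `1` and all multiplicities are absorbed into `U`.
  exact le_iInf₂ fun c' hc' =>
    RoughForm.gaugeNorm_le (RoughForm.abs_sub_le_summedGauge hk hUs (hbound c' hc') hlim)
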